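/- Let $n\ge 2$, let $\Omega\subset\mathbb R^n$ be a bounded open set and $T>0$. Write $C^\infty(\overline\Omega)$ and $C^\infty(\overline\Omega\times[0,T])$ for the restrictions to these sets of $C^\infty$ functions on $\mathbb R^n$ and $\mathbb R^n\times\mathbb R$. Let $c\in C^\infty(\overline\Omega)$ be positive on $\overline\Omega$ (the sound speed), let $G\in C^\infty(\overline\Omega\times[0,T])$ be real valued (the memory kernel), and put $$Qu=-\tfrac12\big(\partial_t^2u-\nabla\cdot(c\nabla u)\big),\qquad Pu(x,t)=Qu(x,t)-\tfrac12\int_0^t\nabla\cdot\big(G(x,t-s)\nabla u(x,s)\big)\,ds .$$ Let $\psi\in C^\infty(\overline\Omega)$ be a real solution of the eikonal equation $|\nabla\psi|=c^{-1/2}$ in $\Omega$, and let $a'_0\in C^\infty(\overline\Omega\times[0,T])$ be a complex valued solution of the transport equation $\mathcal T a'_0=0$ in $\Omega\times[0,T]$, where $$\mathcal T a:=2(\partial_t+c\nabla\psi\cdot\nabla)a+b\,a,\qquad b(x):=(c^{-1}G)(x,0)+\nabla\cdot(c\nabla\psi)(x).$$ (No further geometric assumption is needed once $\psi$ is given; in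 particular the result applies whenever the sound speed is simple and $\psi$ is such a solution.) For a function $a(x,t)$ set $$\mathcal A[a](x,t,s)=-\tfrac12(c^{-1}G)(x,t-s)\,a(x,s),\qquad \mathcal C[a](x,t,s)=-\tfrac12\nabla\cdot\big(G(x,t-s)\nabla a(x,s)\big),$$ $$\mathcal B[a](x,t,s)=-\tfrac12\Big(2G(x,t-s)\nabla\psi(x)\cdot\nabla a(x,s)+\nabla\cdot\big(G(x,t-s)\nabla\psi(x)\big)\,a(x,s)\Big).$$ Then for every $N\in\mathbb N$ there are functions $a'_l,a''_l\in C^\infty(\overline\Omega\times[0,T])$, $l\ge 0$, independent of $k$, with $a'_0$ the given function, such that the following hold. 1. (Transport equations.) For every $l\ge 0$, in $\Omega\times[0,T]$, $$\mathcal T a'_{l+1}=-2\Big(Qa'_l-\sum_{m=0}^{l}\big(\partial_s^{\,l+1-m}\mathcal A[a'_m]+\partial_s^{\,l-m}\mathcal B[a'_m]\big)\big|_{s=t}-\sum_{m=0}^{l-1}\partial_s^{\,l-1-m}\mathcal C[a'_m]\big|_{s=t}\Big).$$ 2. (Volterra integral equations of the second kind.) For every $l\ge 0$, in $\Omega\times[0,T]$,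 $$a''_l(x,t)-\int_0^t(c^{-1}G)(x,t-s)\,a''_l(x,s)\,ds=\mathcal R''_l(x,t),$$ where, with $a''_{-1}=a''_{-2}=0$, $$\mathcal R''_l=-2\Big(c\nabla\psi\cdot\nabla a''_{l-1}+\tfrac12\nabla\cdot(c\nabla\psi)\,a''_{l-1}+\int_0^t\mathcal B[a''_{l-1}]\,ds+Pa''_{l-2}$$ $$\qquad\qquad+\sum_{m=0}^{l}\partial_s^{\,l-m}\mathcal A[a'_m]\big|_{s=0}+\sum_{m=0}^{l-1}\partial_s^{\,l-1-m}\mathcal B[a'_m]\big|_{s=0}+\sum_{m=0}^{l-2}\partial_s^{\,l-2-m}\mathcal C[a'_m]\big|_{s=0}\Big).$$ 3. For $k>0$ the function $$u(x,t)=e^{ik(t-\psi(x))}\Big(a'_0(x,t)+\sum_{l=1}^{N+1}(-ik)^{-l}\big(a'_l(x,t)+e^{-ikt}a''_{l-1}(x,t)\big)\Big)$$ is in $C^\infty(\overline\Omega\times[0,T])$, $Pu\in L^2((0,T),L^2(\Omega))$, and $$\|Pu\|_{L^2((0,T),L^2(\Omega))}=O(k^{-N})\quad\text{as }k\to\infty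 .$$ -/

import Mathlib

open MeasureTheory Set Filter Asymptotics
open scoped ContDiff

noncomputable section

namespace Viscoacoustic

/-- `ℝⁿ` with its Euclidean norm. -/
abbrev Space (n : ℕ) := EuclideanSpace ℝ (Fin n)

variable {n : ℕ}

/-- `C^∞` functions of `(x, t)`. An element of `C^∞(Ω̄ × [0,T])` is the restriction to
`Ω̄ × [0,T]` of such a function; it is represented by one of its smooth extensions. -/
def SmoothST {F : Type*} [NormedAddCommGroup F] [NormedSpace ℝ F] (f : Space n → ℝ → F) : Prop :=
  ContDiff ℝ ∞ (fun p : Space n × ℝ => f p.1 p.2)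

/-- The partial derivative `∂f/∂x_j`. -/
def pderiv {F : Type*} [NormedAddCommGroup F] [NormedSpace ℝ F]
    (j : Fin n) (f : Space n → F) (x : Space n) : F :=
  fderiv ℝ f x (EuclideanSpace.single j 1)

/-- `∇ · (κ ∇f) = ∑_j ∂_j (κ ∂_j f)`. -/
def divGrad {F : Type*} [NormedAddCommGroup F] [NormedSpace ℝ F]
    (κ : Space n → ℝ) (f : Space n → F) (x : Space n) : F :=
  ∑ j, pderiv j (fun y => κ y • pderiv j f y) x

/-- `∇ψ · ∇a` at `(x, t)`, for a real function `ψ` of `x`. -/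
def gradDot (ψ : Space n → ℝ) (a : Space n → ℝ → ℂ) (x : Space n) (t : ℝ) : ℂ :=
  fderiv ℝ (fun y => a y t) x (gradient ψ x)

/-- The wave operator `Q u = -½ (∂_t² u - ∇ · (c ∇u))`. -/
def waveOp (c : Space n → ℝ) (u : Space n → ℝ → ℂ) (x : Space n) (t : ℝ) : ℂ :=
  -(1 / 2) * (iteratedDeriv 2 (fun τ => u x τ) t - divGrad c (fun y => u y t) x)

/-- The memory operator `R u (x, t) = -½ ∫_0^t ∇ · (G(x, t-s) ∇u(x, s)) ds`. -/
def memoryOp (G : Space n → ℝ → ℝ) (u : Space n → ℝ → ℂ) (x : Space n) (t : ℝ) : ℂ :=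
  -(1 / 2) * ∫ s in (0 : ℝ)..t, divGrad (fun y => G y (t - s)) (fun y => u y s) x

/-- The viscoacoustic operator `P = Q + R`. -/
def viscoOp (c : Space n → ℝ) (G : Space n → ℝ → ℝ) (u : Space n → ℝ → ℂ)
    (x : Space n) (t : ℝ) : ℂ :=
  waveOp c u x t + memoryOp G u x t

/-- `𝒜[a](x,t,s) = -½ (c⁻¹G)(x,t-s) a(x,s)`. -/
def memA (c : Space n → ℝ) (G : Space n → ℝ → ℝ) (a : Space n → ℝ → ℂ)
    (x : Space n) (t s : ℝ) : ℂ :=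
  -(1 / 2) * (((c x)⁻¹ * G x (t - s) : ℝ) : ℂ) * a x s

/-- `ℬ[a](x,t,s) = -½ (2 G(x,t-s) ∇ψ·∇a(x,s) + ∇·(G(x,t-s)∇ψ) a(x,s))`. -/
def memB (G : Space n → ℝ → ℝ) (ψ : Space n → ℝ) (a : Space n → ℝ → ℂ)
    (x : Space n) (t s : ℝ) : ℂ :=
  -(1 / 2) * (2 * (G x (t - s) : ℂ) * gradDot ψ a x s
    + ((divGrad (fun y => G y (t - s)) ψ x : ℝ) : ℂ) * a x s)

/-- `𝒞[a](x,t,s) = -½ ∇·(G(x,t-s) ∇a(x,s))`. -/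
def memC (G : Space n → ℝ → ℝ) (a : Space n → ℝ → ℂ) (x : Space n) (t s : ℝ) : ℂ :=
  -(1 / 2) * divGrad (fun y => G y (t - s)) (fun y => a y s) x

/-- The zeroth order coefficient `b = c⁻¹ G(·,0) + ∇·(c∇ψ)` of the transport equation. -/
def transportCoeff (c : Space n → ℝ) (G : Space n → ℝ → ℝ) (ψ : Space n → ℝ)
    (x : Space n) : ℝ :=
  (c x)⁻¹ * G x 0 + divGrad c ψ x

/-- The transport operator `2 (∂_t + c ∇ψ·∇) a + b a`. -/
def transportOp (c : Space n → ℝ) (G : Space n → ℝ → ℝ) (ψ : Space n → ℝ)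
    (a : Space n → ℝ → ℂ) (x : Space n) (t : ℝ) : ℂ :=
  2 * (deriv (fun τ => a x τ) t + (c x : ℂ) * gradDot ψ a x t)
    + (transportCoeff c G ψ x : ℂ) * a x t

/-- Right-hand side of the `l`-th transport equation. It is `0` for `l = 0`, and for `l + 1` it is
`-2 (Q a_l - ∑_{m ≤ l} (∂_s^{l+1-m} 𝒜[a_m] + ∂_s^{l-m} ℬ[a_m]) - ∑_{m < l} ∂_s^{l-1-m} 𝒞[a_m])`,
the `s`-derivatives being evaluated at `s = t`. -/
def transportSource (c : Space n → ℝ) (G : Space n → ℝ → ℝ) (ψ : Space n → ℝ)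
    (a : ℕ → Space n → ℝ → ℂ) : ℕ → Space n → ℝ → ℂ
  | 0, _, _ => 0
  | l + 1, x, t => -2 * (waveOp c (a l) x t
      - ∑ m ∈ Finset.range (l + 1),
          (iteratedDeriv (l + 1 - m) (fun s => memA c G (a m) x t s) t
            + iteratedDeriv (l - m) (fun s => memB G ψ (a m) x t s) t)
      - ∑ m ∈ Finset.range l, iteratedDeriv (l - 1 - m) (fun s => memC G (a m) x t s) t)

/-- The Volterra operator of the second kind
`(V a)(x,t) = a(x,t) - ∫_0^t (c⁻¹G)(x,t-s) a(x,s) ds`. -/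
def volterraOp (c : Space n → ℝ) (G : Space n → ℝ → ℝ) (a : Space n → ℝ → ℂ)
    (x : Space n) (t : ℝ) : ℂ :=
  a x t - ∫ s in (0 : ℝ)..t, (((c x)⁻¹ * G x (t - s) : ℝ) : ℂ) * a x s

/-- `c ∇ψ·∇a + ½ ∇·(c∇ψ) a + ∫_0^t ℬ[a](x,t,s) ds`. -/
def firstOrderOp (c : Space n → ℝ) (G : Space n → ℝ → ℝ) (ψ : Space n → ℝ)
    (a : Space n → ℝ → ℂ) (x : Space n) (t : ℝ) : ℂ :=
  (c x : ℂ) * gradDot ψ a x t + (1 / 2) * ((divGrad c ψ x : ℝ) : ℂ) * a x t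
    + ∫ s in (0 : ℝ)..t, memB G ψ a x t s

/-- The part of the right-hand side of the `l`-th Volterra equation which comes from
`a''_{l-1}` and `a''_{l-2}`. -/
def volterraLower (c : Space n → ℝ) (G : Space n → ℝ → ℝ) (ψ : Space n → ℝ)
    (a'' : ℕ → Space n → ℝ → ℂ) : ℕ → Space n → ℝ → ℂ
  | 0, _, _ => 0
  | 1, x, t => firstOrderOp c G ψ (a'' 0) x t
  | l + 2, x, t => firstOrderOp c G ψ (a'' (l + 1)) x t + viscoOp c G (a'' l) x t

/-- Right-hand side of the `l`-th Volterra equation. It depends only on `a''_m` for `m < l` and on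
`a'_m` for `m ≤ l`; the `s`-derivatives are evaluated at `s = 0`. -/
def volterraSource (c : Space n → ℝ) (G : Space n → ℝ → ℝ) (ψ : Space n → ℝ)
    (a' a'' : ℕ → Space n → ℝ → ℂ) (l : ℕ) (x : Space n) (t : ℝ) : ℂ :=
  -2 * (volterraLower c G ψ a'' l x t
      + ∑ m ∈ Finset.range (l + 1), iteratedDeriv (l - m) (fun s => memA c G (a' m) x t s) 0
      + ∑ m ∈ Finset.range l, iteratedDeriv (l - 1 - m) (fun s => memB G ψ (a' m) x t s) 0
      + ∑ m ∈ Finset.range (l - 1), iteratedDeriv (l - 2 - m) (fun s => memC G (a' m) x t s) 0)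

/-- The geometrical optics ansatz
`e^{ik(t-ψ)} (a'_0 + ∑_{l=1}^L (-ik)^{-l} (a'_l + e^{-ikt} a''_{l-1}))`. -/
def ansatz (ψ : Space n → ℝ) (a' a'' : ℕ → Space n → ℝ → ℂ) (L : ℕ) (k : ℝ)
    (x : Space n) (t : ℝ) : ℂ :=
  Complex.exp (Complex.I * k * (t - ψ x)) *
    (a' 0 x t + ∑ l ∈ Finset.Icc 1 L, ((-(Complex.I * k)) ^ l)⁻¹ *
      (a' l x t + Complex.exp (-(Complex.I * k * t)) * a'' (l - 1) x t))

/-- The norm of `L²((0,T), L²(Ω)) = L²(Ω × (0,T))`, for functions in that space. -/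
def normL2 (Ω : Set (Space n)) (T : ℝ) (f : Space n → ℝ → ℂ) : ℝ :=
  (eLpNorm (fun p : Space n × ℝ => f p.1 p.2) 2 (volume.restrict (Ω ×ˢ Ioo 0 T))).toReal

/-- Membership in `L²((0,T), L²(Ω)) = L²(Ω × (0,T))`. -/
def MemL2 (Ω : Set (Space n)) (T : ℝ) (f : Space n → ℝ → ℂ) : Prop :=
  MemLp (fun p : Space n × ℝ => f p.1 p.2) 2 (volume.restrict (Ω ×ˢ Ioo 0 T))

end Viscoacoustic

end

/-! Put κ = -ik, so that the prefactor of the ansatz is exp(κψ)exp(-κt). Conjugation by exp(κψ)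
turns P into P + κF + (κ²/2)V, where F is `firstOrderOp` and V is the Volterra operator; the eikonal
equation makes the identity part of V have coefficient one (`viscoOp_exp_mul`). On exp(-κt)a the
local κ² terms cancel. What is left is a transport operator at order κ and memory integrals of
exp(-κs)(𝒞 + κℬ + κ²𝒜) (`viscoOp_wave`).

Each integration by parts in s trades a power of κ for two boundary terms (`mul_laplaceIntegral`).
The one at s = t carries exp(-κt) and is absorbed by the transport equation of the next a'. The one
at s = 0 does not oscillate in time, so no term of the form exp(-κt)a' can remove it; it is removed
by the correction exp(κψ)a'', on which P acts at leading order as (κ²/2)V. This is why two families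
are needed. Induction on the number L of corrections gives an exact residual, κ^(-L) times terms of
size O(k) (`viscoOp_ansatz`); L = N + 1 yields k^(-N) uniformly on Ω × [0,T], hence in L².

The amplitudes exist because both hierarchies are triangular. Transport equations are solved along
the flow of c∇ψ, cut off outside Ω; the second family solves linear Volterra equations. The flow and
the Volterra solutions both come from one result, smooth solvability of Lipschitz Volterra equations
with parameters (`exists_contDiff_volterra_real`), proved by iteration and the implicit function
theorem in C([0,1], E). Finally c is replaced by a globally positive function equal to it on the
open set Ω, which changes nothing at points of Ω. -/

noncomputable section

namespace Viscoacoustic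

open scoped Topology

/-! ### Smoothness of w ↦ f ∘ w on spaces of continuous functions -/

section Superposition

variable {K : Type} [TopologicalSpace K] [CompactSpace K]
  {E F : Type} [NormedAddCommGroup E] [NormedSpace ℝ E] [NormedAddCommGroup F] [NormedSpace ℝ F]

/-- Pointwise application of a continuous family of operators to a continuous function. -/
def pointwiseApply : C(K, E →L[ℝ] F) →L[ℝ] C(K, E) →L[ℝ] C(K, F) :=
  LinearMap.mkContinuous₂
    (LinearMap.mk₂ ℝ (fun (A : C(K, E →L[ℝ] F)) (w : C(K, E)) =>
        (⟨fun x => A x (w x), by fun_prop⟩ : C(K, F)))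
      (fun _ _ _ => by ext; simp) (fun _ _ _ => by ext; simp)
      (fun _ _ _ => by ext; simp) (fun _ _ _ => by ext; simp)) 1
    (fun A w => by
      rw [one_mul]
      refine (ContinuousMap.norm_le _ (by positivity)).2 fun x => ?_
      exact ((A x).le_opNorm _).trans
        (mul_le_mul (A.norm_coe_le_norm x) (w.norm_coe_le_norm x) (norm_nonneg _) (norm_nonneg A)))

@[simp]
theorem pointwiseApply_apply (A : C(K, E →L[ℝ] F)) (w : C(K, E)) (x : K) :
    pointwiseApply A w x = A x (w x) := rfl

/-- The mean value inequality is applied on each segment from w x to v x. Compactness of K makes the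
derivative of f close to its value at w x, uniformly in x, since postcomposition is continuous for
the sup norm. -/
theorem hasFDerivAt_superposition {f : E → F} (hf : ContDiff ℝ 1 f) (w : C(K, E)) :
    HasFDerivAt (fun w : C(K, E) => (⟨f, hf.continuous⟩ : C(E, F)).comp w)
      (pointwiseApply
        ((⟨fderiv ℝ f, hf.continuous_fderiv one_ne_zero⟩ : C(E, E →L[ℝ] F)).comp w)) w := by
  rw [hasFDerivAt_iff_isLittleO, isLittleO_iff]
  intro ε hε
  set D : C(E, E →L[ℝ] F) := ⟨fderiv ℝ f, hf.continuous_fderiv one_ne_zero⟩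
  have hD : Continuous fun w : C(K, E) => D.comp w := ContinuousMap.continuous_postcomp D
  obtain ⟨δ, hδ, h⟩ : ∃ δ > 0, ∀ v : C(K, E), dist v w < δ → dist (D.comp v) (D.comp w) < ε :=
    Metric.tendsto_nhds_nhds.1 (hD.tendsto w) ε hε
  filter_upwards [Metric.ball_mem_nhds w hδ] with v hv
  refine (ContinuousMap.norm_le _ (by positivity)).2 fun x => ?_
  have hmv := (convex_segment (w x) (v x)).norm_image_sub_le_of_norm_fderiv_le' (f := f)
    (φ := fderiv ℝ f (w x)) (C := ε)
    (fun y _ => (hf.differentiable one_ne_zero) y) (fun y hy => ?_)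
    (left_mem_segment ℝ _ _) (right_mem_segment ℝ _ _)
  · exact hmv.trans (mul_le_mul_of_nonneg_left ((v - w).norm_coe_le_norm x) hε.le)
  · rw [segment_eq_image'] at hy
    obtain ⟨θ, hθ, rfl⟩ := hy
    have h1 : dist (w + θ • (v - w)) w < δ := by
      rw [dist_eq_norm, add_sub_cancel_left, norm_smul, Real.norm_of_nonneg hθ.1, ← dist_eq_norm]
      exact (mul_le_of_le_one_left dist_nonneg hθ.2).trans_lt hv
    have h2 := (ContinuousMap.dist_apply_le_dist (f := D.comp (w + θ • (v - w)))
      (g := D.comp w) x).trans (h _ h1).le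
    rwa [dist_eq_norm] at h2

/-- The derivative is a bounded bilinear pairing applied to superposition by `fderiv ℝ f`, which has
one derivative less. The target space is generalised because it changes from F to E →L[ℝ] F in the
induction. -/
theorem contDiff_superposition_nat (m : ℕ) :
    ∀ {F : Type} [NormedAddCommGroup F] [NormedSpace ℝ F] {f : E → F} (hf : ContDiff ℝ m f),
      ContDiff ℝ m (fun w : C(K, E) => (⟨f, hf.continuous⟩ : C(E, F)).comp w) := by
  induction m with
  | zero =>
    intro F _ _ f hf
    exact contDiff_zero.2 (ContinuousMap.continuous_postcomp _)
  | succ m ih =>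
    intro F _ _ f hf
    refine contDiff_succ_iff_hasFDerivAt.2 ⟨_, ?_, fun w => hasFDerivAt_superposition
      (hf.of_le (by exact_mod_cast Nat.le_add_left 1 m)) w⟩
    exact (pointwiseApply (K := K) (E := E) (F := F)).contDiff.comp
      (ih (f := fderiv ℝ f) (hf.fderiv_right (by norm_cast)))

theorem contDiff_superposition {f : E → F} (hf : ContDiff ℝ ∞ f) :
    ContDiff ℝ ∞ (fun w : C(K, E) => (⟨f, hf.continuous⟩ : C(E, F)).comp w) :=
  contDiff_infty.2 fun m => contDiff_superposition_nat m (hf.of_le (by exact_mod_cast le_top))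

end Superposition

/-! ### Volterra integral equations with smooth parameters -/

section Volterra

local notation "𝕀" => unitInterval

variable {E F : Type} [NormedAddCommGroup E] [NormedSpace ℝ E] [NormedAddCommGroup F]
  [NormedSpace ℝ F]

/-- The nearest point of `[0, 1]`. -/
def toUnit (s : ℝ) : 𝕀 := projIcc 0 1 zero_le_one s

@[fun_prop]
theorem continuous_toUnit : Continuous toUnit := continuous_projIcc (h := zero_le_one)

theorem toUnit_coe (s : 𝕀) : toUnit (s : ℝ) = s := projIcc_val _ _

theorem coe_toUnit {s : ℝ} (hs : s ∈ Icc (0 : ℝ) 1) : (toUnit s : ℝ) = s := by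
  rw [toUnit, projIcc_of_mem _ hs]

/-- `(J g)(s) = ∫_0^s g(s, r) dr`. -/
def kernelIntegral : C(𝕀 × 𝕀, E) →L[ℝ] C(𝕀, E) :=
  LinearMap.mkContinuous
    { toFun := fun g => ⟨fun s => ∫ r in (0 : ℝ)..s, g (s, toUnit r),
        intervalIntegral.continuous_parametric_intervalIntegral_of_continuous (μ := volume)
          (f := fun (s : 𝕀) r => g (s, toUnit r)) (by fun_prop) (by fun_prop)⟩
      map_add' := fun f g => by
        ext s
        simp only [ContinuousMap.add_apply, ContinuousMap.coe_mk]
        exact intervalIntegral.integral_add (Continuous.intervalIntegrable (by fun_prop) _ _)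
          (Continuous.intervalIntegrable (by fun_prop) _ _)
      map_smul' := fun r g => by
        ext s
        simp } 1
    (fun g => by
      rw [one_mul]
      refine (ContinuousMap.norm_le _ (norm_nonneg _)).2 fun s => ?_
      refine (intervalIntegral.norm_integral_le_of_norm_le_const
        (fun r _ => g.norm_coe_le_norm _)).trans ?_
      rw [sub_zero, abs_of_nonneg s.2.1]
      exact mul_le_of_le_one_right (norm_nonneg _) s.2.2)

theorem kernelIntegral_apply (g : C(𝕀 × 𝕀, E)) (s : 𝕀) :
    kernelIntegral g s = ∫ r in (0 : ℝ)..s, g (s, toUnit r) := rfl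

/-- Iterating the bound and integrating powers of r gives N^[m] the Lipschitz constant L^m/m!. Some
iterate is therefore a contraction, whatever the size of L, and its unique fixed point is that of N.
-/
theorem existsUnique_fixedPoint_of_volterra {X : Type} [NormedAddCommGroup X] [CompleteSpace X]
    (N : C(𝕀, X) → C(𝕀, X)) (L : ℝ) (hL : 0 ≤ L)
    (h : ∀ v w s, ‖N v s - N w s‖ ≤ L * ∫ r in (0 : ℝ)..s, ‖v (toUnit r) - w (toUnit r)‖) :
    ∃! w, N w = w := by
  have hn : ∀ m v w s, ‖(N^[m]) v s - (N^[m]) w s‖ ≤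
      (L * s) ^ m / m.factorial * ‖v - w‖ := by
    intro m v w
    induction m with
    | zero => intro s; simpa using (v - w).norm_coe_le_norm s
    | succ m ih =>
      intro s
      rw [Function.iterate_succ_apply', Function.iterate_succ_apply']
      refine (h _ _ s).trans ?_
      have h1 : ∫ r in (0 : ℝ)..s, ‖(N^[m]) v (toUnit r) - (N^[m]) w (toUnit r)‖ ≤
          ∫ r in (0 : ℝ)..s, (L ^ m / m.factorial * ‖v - w‖) * r ^ m := by
        refine intervalIntegral.integral_mono_on s.2.1
          (Continuous.intervalIntegrable (by fun_prop) _ _)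
          (Continuous.intervalIntegrable (by fun_prop) _ _) fun r hr => ?_
        refine (ih _).trans (le_of_eq ?_)
        rw [coe_toUnit ⟨hr.1, hr.2.trans s.2.2⟩, mul_pow]
        ring
      refine (mul_le_mul_of_nonneg_left h1 hL).trans (le_of_eq ?_)
      rw [intervalIntegral.integral_const_mul, integral_pow, Nat.factorial_succ]
      push_cast
      field_simp
      simp only [ne_eq, Nat.add_eq_zero_iff, one_ne_zero, and_false, not_false_eq_true, zero_pow, sub_zero]
      ring
  obtain ⟨m, hm⟩ := ((FloorSemiring.tendsto_pow_div_factorial_atTop L).eventually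
    (gt_mem_nhds (show (0 : ℝ) < 1 / 2 by norm_num))).exists
  have hc : ContractingWith (1 / 2) N^[m] := by
    refine ⟨by norm_num, LipschitzWith.of_dist_le_mul fun v w => ?_⟩
    rw [dist_eq_norm, dist_eq_norm]
    refine (ContinuousMap.norm_le _ (by positivity)).2 fun s => ?_
    refine (hn m v w s).trans (mul_le_mul_of_nonneg_right ?_ (norm_nonneg _))
    have : (L * s) ^ m ≤ L ^ m :=
      pow_le_pow_left₀ (mul_nonneg hL s.2.1) (mul_le_of_le_one_right hL s.2.2) m
    calc (L * s) ^ m / m.factorial ≤ L ^ m / m.factorial := by gcongr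
      _ ≤ _ := by simpa using hm.le
  refine ⟨_, hc.isFixedPt_fixedPoint_iterate, fun w hw => ?_⟩
  exact hc.fixedPoint_unique (Function.IsFixedPt.iterate hw m)

/-- The graph map `w ↦ ((s, r) ↦ (p, s, r, w r))`. -/
def volterraGraph {P : Type} [NormedAddCommGroup P] [NormedSpace ℝ P] (p : P) (w : C(𝕀, E)) :
    C(𝕀 × 𝕀, P × ℝ × ℝ × E) :=
  ⟨fun z => (p, z.1, z.2, w z.2), by fun_prop⟩

variable {P : Type} [NormedAddCommGroup P] [NormedSpace ℝ P]

/-- The graph map is affine: a bounded linear map plus its value at the origin. -/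
theorem contDiff_volterraGraph :
    ContDiff ℝ ∞ (fun q : P × C(𝕀, E) => volterraGraph q.1 q.2) := by
  let L : P × C(𝕀, E) →L[ℝ] C(𝕀 × 𝕀, P × ℝ × ℝ × E) :=
    LinearMap.mkContinuous
      { toFun := fun q => ⟨fun z => (q.1, 0, 0, q.2 z.2), by fun_prop⟩
        map_add' := fun _ _ => by ext <;> simp
        map_smul' := fun _ _ => by ext <;> simp } 1
      (fun q => by
        rw [one_mul]
        refine (ContinuousMap.norm_le _ (norm_nonneg _)).2 fun z => ?_
        simp only [LinearMap.coe_mk, AddHom.coe_mk, ContinuousMap.coe_mk, Prod.norm_def, norm_zero]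
        have := q.2.norm_coe_le_norm z.2
        refine max_le (le_max_left _ _) (max_le (by positivity) (max_le (by positivity) ?_))
        exact this.trans (le_max_right _ _))
  have : (fun q : P × C(𝕀, E) => volterraGraph q.1 q.2) =
      fun q => L q + volterraGraph (0 : P) (0 : C(𝕀, E)) := by
    funext q
    ext z <;> simp [L, volterraGraph]
  rw [this]
  exact L.contDiff.add contDiff_const

theorem contDiff_curry_unit {f : P × ℝ → F} (hf : ContDiff ℝ ∞ f) :
    ContDiff ℝ ∞ (fun p : P => (⟨fun s => f (p, s), by
      have := hf.continuous; fun_prop⟩ : C(𝕀, F))) := by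
  let L : P →L[ℝ] C(𝕀, P × ℝ) :=
    LinearMap.mkContinuous
      { toFun := fun q => ⟨fun z => (q, 0), by fun_prop⟩
        map_add' := fun _ _ => by ext <;> simp
        map_smul' := fun _ _ => by ext <;> simp } 1
      (fun q => by
        rw [one_mul]
        exact (ContinuousMap.norm_le _ (norm_nonneg _)).2 fun z => by simp)
  have hL : ContDiff ℝ ∞ fun p : P => L p + ⟨fun s : 𝕀 => ((0 : P), (s : ℝ)), by fun_prop⟩ :=
    L.contDiff.add contDiff_const
  have := (contDiff_superposition (K := 𝕀) hf).comp hL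
  convert this using 2 with p
  ext s
  simp [L]

/-- The nonlinear Volterra equation `w(s) = R(p,s) + ∫_0^s Φ(p,s,r,w(r)) dr` on `[0,1]`, Lipschitz
in `w`, has a unique solution, which is a smooth function of the parameter `p`. -/
theorem exists_contDiff_volterra [CompleteSpace E] [CompleteSpace P] {Φ : P × ℝ × ℝ × E → E}
    (hΦ : ContDiff ℝ ∞ Φ) {R : P × ℝ → E} (hR : ContDiff ℝ ∞ R)
    (hlip : ∀ p, ∃ L : ℝ, 0 ≤ L ∧ ∀ s ∈ Icc (0 : ℝ) 1, ∀ r ∈ Icc (0 : ℝ) 1, ∀ v w,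
      ‖Φ (p, s, r, v) - Φ (p, s, r, w)‖ ≤ L * ‖v - w‖) :
    ∃ w : P → C(𝕀, E), ContDiff ℝ ∞ w ∧
      (∀ p, ∀ s : 𝕀, w p s = R (p, s) + ∫ r in (0 : ℝ)..s, Φ (p, s, r, w p (toUnit r))) ∧
      ∀ p, ∀ v : C(𝕀, E), (∀ s : 𝕀, v s = R (p, s) + ∫ r in (0 : ℝ)..s, Φ (p, s, r, v (toUnit r))) →
        v = w p := by
  let ρ : P → C(𝕀, E) := fun p => ⟨fun s => R (p, s), by have := hR.continuous; fun_prop⟩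
  have hρ : ContDiff ℝ ∞ ρ := contDiff_curry_unit hR
  let Ψ : P × C(𝕀, E) → C(𝕀 × 𝕀, E) := fun q =>
    (⟨Φ, hΦ.continuous⟩ : C(P × ℝ × ℝ × E, E)).comp (volterraGraph q.1 q.2)
  have hΨ : ContDiff ℝ ∞ Ψ := (contDiff_superposition hΦ).comp contDiff_volterraGraph
  let N : P → C(𝕀, E) → C(𝕀, E) := fun p w => ρ p + kernelIntegral (Ψ (p, w))
  have hsol : ∀ p, ∃! w, N p w = w := by
    intro p
    obtain ⟨L, hL, hl⟩ := hlip p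
    refine existsUnique_fixedPoint_of_volterra (N p) L hL fun v w s => ?_
    simp only [N, ContinuousMap.add_apply, add_sub_add_left_eq_sub]
    rw [← ContinuousMap.sub_apply, ← map_sub, kernelIntegral_apply,
      ← intervalIntegral.integral_const_mul]
    refine intervalIntegral.norm_integral_le_of_norm_le s.2.1 (ae_of_all _ fun r _ => ?_)
      (Continuous.intervalIntegrable (by fun_prop) _ _)
    exact hl _ s.2 _ (toUnit r).2 _ _
  choose w hw hu using hsol
  have hN : ∀ p v s, N p v s = R (p, s) + ∫ r in (0 : ℝ)..s, Φ (p, s, r, v (toUnit r)) := by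
    intro p v s
    simp only [N, ρ, ContinuousMap.add_apply, ContinuousMap.coe_mk, kernelIntegral_apply]
    congr 1
    refine intervalIntegral.integral_congr fun r hr => ?_
    rw [uIcc_of_le s.2.1] at hr
    change Φ (p, s, (toUnit r : ℝ), v (toUnit r)) = _
    rw [coe_toUnit ⟨hr.1, hr.2.trans s.2.2⟩]
  refine ⟨w, contDiff_iff_contDiffAt.2 fun p => ?_,
    fun p s => (DFunLike.congr_fun (hw p) s).symm.trans (hN p _ s),
    fun p v hv => hu p v (ContinuousMap.ext fun s => (hN p v s).trans (hv s).symm)⟩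
  -- The zero set of Z is exactly the graph of p ↦ w p, so smoothness of w reduces to invertibility
  -- of the partial derivative of Z in the second variable.
  let Z : P × C(𝕀, E) → C(𝕀, E) := fun q => q.2 - (ρ q.1 + kernelIntegral (Ψ q))
  have hZ : ContDiff ℝ ∞ Z :=
    contDiff_snd.sub ((hρ.comp contDiff_fst).add ((kernelIntegral (E := E)).contDiff.comp hΨ))
  have hZ0 : ∀ q v, Z (q, v) = 0 ↔ v = w q := by
    intro q v
    refine ⟨fun h => hu q v (sub_eq_zero.1 h).symm, ?_⟩
    rintro rfl
    exact sub_eq_zero.2 (hw q).symm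
  let A : C(𝕀 × 𝕀, E →L[ℝ] E) :=
    ⟨fun z => (fderiv ℝ Φ (p, z.1, z.2, w p z.2)).comp
      ((ContinuousLinearMap.inr ℝ P (ℝ × ℝ × E)).comp
        ((ContinuousLinearMap.inr ℝ ℝ (ℝ × E)).comp (ContinuousLinearMap.inr ℝ ℝ E))), by
      have := hΦ.continuous_fderiv (by simp)
      fun_prop⟩
  let J : C(𝕀, E) → C(𝕀, E) := fun v =>
    kernelIntegral (pointwiseApply A (v.comp ⟨Prod.snd, continuous_snd⟩))
  -- That partial derivative is I - J, where J is the linear Volterra operator whose kernel is the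
  -- derivative of Φ in its last variable.
  have hD : ∀ v, (fderiv ℝ Z (p, w p) ∘L .inr ℝ P C(𝕀, E)) v = v - J v := by
    intro v
    have h1 : HasFDerivAt (fun u : C(𝕀, E) => Z (p, u))
        (fderiv ℝ Z (p, w p) ∘L .inr ℝ P C(𝕀, E)) (w p) :=
      ((hZ.differentiable (by simp)) (p, w p)).hasFDerivAt.comp (w p)
        (hasFDerivAt_prodMk_right p (w p))
    have h2 : HasFDerivAt (fun u : C(𝕀, E) => volterraGraph p u)
        (fderiv ℝ (fun u : C(𝕀, E) => volterraGraph p u) (w p)) (w p) := by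
      have : ContDiff ℝ ∞ (fun u : C(𝕀, E) => volterraGraph p u) :=
        contDiff_volterraGraph.comp (contDiff_prodMk_right p)
      exact ((this.differentiable (by simp)) (w p)).hasFDerivAt
    have h3 : fderiv ℝ (fun u : C(𝕀, E) => volterraGraph p u) (w p) v =
        ⟨fun z => (0, 0, 0, v z.2), by fun_prop⟩ := by
      have h4 := h2.hasLineDerivAt v
      refine h4.unique ?_
      have h5 : (fun t : ℝ => volterraGraph p (w p + t • v)) = fun t : ℝ =>
          volterraGraph p (w p) + t • (⟨fun z => (0, 0, 0, v z.2), by fun_prop⟩ :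
            C(𝕀 × 𝕀, P × ℝ × ℝ × E)) := by
        funext t
        ext z <;> simp [volterraGraph]
      rw [HasLineDerivAt, h5]
      simpa using ((hasDerivAt_id (0 : ℝ)).smul_const
        (⟨fun z => (0, 0, 0, v z.2), by fun_prop⟩ : C(𝕀 × 𝕀, P × ℝ × ℝ × E))).const_add
          (volterraGraph p (w p))
    have h6 := (hasFDerivAt_superposition (hΦ.of_le (by simp)) (volterraGraph p (w p))).comp
      (w p) h2
    have h7 := (hasFDerivAt_id (𝕜 := ℝ) (w p)).sub
      (((kernelIntegral (E := E)).hasFDerivAt.comp (w p) h6).const_add (ρ p))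
    have h8 := congrArg (fun T : C(𝕀, E) →L[ℝ] C(𝕀, E) => T v) (h1.unique h7)
    refine h8.trans ?_
    change v - kernelIntegral (pointwiseApply _ (fderiv ℝ _ (w p) v)) = _
    rw [h3]
    congr 2
  have hbij : Function.Bijective (fderiv ℝ Z (p, w p) ∘L .inr ℝ P C(𝕀, E)) := by
    -- The linearised equation is again of Volterra type, so the same fixed-point lemma inverts I -
    -- J; boundedness of the inverse then comes from the open mapping theorem.
    have key : ∀ r : C(𝕀, E), ∃! v, r + J v = v := by
      intro r
      refine existsUnique_fixedPoint_of_volterra _ ‖A‖ (norm_nonneg A) fun u v s => ?_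
      simp only [J, ContinuousMap.add_apply, add_sub_add_left_eq_sub]
      rw [← ContinuousMap.sub_apply, ← map_sub, kernelIntegral_apply,
        ← intervalIntegral.integral_const_mul]
      refine intervalIntegral.norm_integral_le_of_norm_le s.2.1 (ae_of_all _ fun r _ => ?_)
        (Continuous.intervalIntegrable (by fun_prop) _ _)
      rw [← map_sub, pointwiseApply_apply]
      exact ((A _).le_opNorm _).trans
        (mul_le_mul_of_nonneg_right (A.norm_coe_le_norm _) (norm_nonneg _))
    rw [Function.bijective_iff_existsUnique]
    intro r
    obtain ⟨v, hv, hvu⟩ := key r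
    refine ⟨v, ?_, fun u hu => hvu u ?_⟩
    · change (fderiv ℝ Z (p, w p) ∘L .inr ℝ P C(𝕀, E)) v = r
      rw [hD, sub_eq_iff_eq_add]; exact hv.symm
    · have hu' : (fderiv ℝ Z (p, w p) ∘L .inr ℝ P C(𝕀, E)) u = r := hu
      rw [hD, sub_eq_iff_eq_add] at hu'; exact hu'.symm
  have hinv : (fderiv ℝ Z (p, w p) ∘L .inr ℝ P C(𝕀, E)).IsInvertible :=
    ⟨ContinuousLinearEquiv.ofBijective _ (LinearMap.ker_eq_bot.2 hbij.1)
      (LinearMap.range_eq_top.2 hbij.2), rfl⟩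
  have hcd : ContDiffAt ℝ ∞ Z (p, w p) := hZ.contDiffAt
  refine (hcd.contDiffAt_implicitFunction (by simp) hinv).congr_of_eventuallyEq ?_
  -- The implicit function produces zeros of Z near p; by uniqueness it coincides there with w.
  filter_upwards [hcd.eventually_apply_implicitFunction (by simp) hinv] with q hq
  rw [(hZ0 p _).2 rfl] at hq
  exact ((hZ0 q _).1 hq).symm

/-- The nonlinear Volterra equation `u(x,t) = R(x,t) + ∫_0^t Φ(x,t,s,u(x,s)) ds`, Lipschitz in `u`,
has a jointly smooth solution on the whole time axis. -/
theorem exists_contDiff_volterra_real [CompleteSpace E] [CompleteSpace P] {Φ : P × ℝ × ℝ × E → E}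
    (hΦ : ContDiff ℝ ∞ Φ) {R : P × ℝ → E} (hR : ContDiff ℝ ∞ R)
    (hlip : ∀ p M, ∃ L : ℝ, 0 ≤ L ∧ ∀ t s, |t| ≤ M → |s| ≤ M → ∀ v w,
      ‖Φ (p, t, s, v) - Φ (p, t, s, w)‖ ≤ L * ‖v - w‖) :
    ∃ u : P × ℝ → E, ContDiff ℝ ∞ u ∧
      ∀ p t, u (p, t) = R (p, t) + ∫ s in (0 : ℝ)..t, Φ (p, t, s, u (p, s)) := by
  -- Time is rescaled to [0,1] and t becomes a parameter: w (x, t) s plays the role of u(x, ts).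
  -- Negative t needs no separate treatment.
  obtain ⟨w, hw, heq, huniq⟩ := exists_contDiff_volterra (P := P × ℝ)
    (Φ := fun q => q.1.2 • Φ (q.1.1, q.1.2 * q.2.1, q.1.2 * q.2.2.1, q.2.2.2))
    (R := fun q => R (q.1.1, q.1.2 * q.2)) (by fun_prop) (by fun_prop) (by
      intro p
      obtain ⟨L, hL, h⟩ := hlip p.1 |p.2|
      refine ⟨|p.2| * L, by positivity, fun s hs r hr v w => ?_⟩
      simp only [← smul_sub, norm_smul, Real.norm_eq_abs, mul_assoc]
      have hb : ∀ s ∈ Icc (0 : ℝ) 1, |p.2 * s| ≤ |p.2| := fun s hs => by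
        rw [abs_mul, abs_of_nonneg hs.1]
        exact mul_le_of_le_one_right (abs_nonneg _) hs.2
      gcongr
      exact h _ _ (hb s hs) (hb r hr) v w)
  -- Both sides solve the rescaled problem with parameter (x, ts), so uniqueness makes the solutions
  -- for different t fit together into a single function of (x, t).
  have hscale : ∀ x t, ∀ s : 𝕀, w (x, t) s = w (x, t * s) 1 := by
    intro x t s
    have h := huniq (x, t * s) ⟨fun σ => w (x, t) (s * σ), by fun_prop⟩ (fun σ => by
      simp only [ContinuousMap.coe_mk]
      rw [heq]
      simp only [Icc.coe_mul, mul_assoc]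
      congr 1
      have h1 := intervalIntegral.smul_integral_comp_mul_left (a := 0) (b := (σ : ℝ))
        (fun r => t • Φ (x, t * (s * σ), t * r, w (x, t) (toUnit r))) (s : ℝ)
      rw [mul_zero] at h1
      rw [← h1, ← intervalIntegral.integral_smul]
      refine intervalIntegral.integral_congr fun r hr => ?_
      rw [uIcc_of_le σ.2.1] at hr
      have h2 : toUnit (s * r) = s * toUnit r := by
        rw [← toUnit_coe (s * toUnit r), Icc.coe_mul,
          coe_toUnit ⟨hr.1, hr.2.trans σ.2.2⟩]
      simp only [h2, smul_smul]
      rw [mul_comm (s : ℝ) t])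
    rw [← h]
    simp
  refine ⟨fun q => w q 1, (ContinuousMap.evalCLM ℝ (M := E) (1 : 𝕀)).contDiff.comp hw,
    fun x t => ?_⟩
  have h := heq (x, t) 1
  simp only [Icc.coe_one, mul_one] at h
  refine h.trans ?_
  congr 1
  have h1 := intervalIntegral.smul_integral_comp_mul_left (a := 0) (b := 1)
    (fun s => Φ (x, t, s, w (x, s) 1)) t
  rw [mul_zero, mul_one] at h1
  rw [← h1, ← intervalIntegral.integral_smul]
  refine intervalIntegral.integral_congr fun r hr => ?_
  rw [uIcc_of_le zero_le_one] at hr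
  rw [hscale, coe_toUnit hr]

theorem contDiff_integral_unit [CompleteSpace F] {f : P × ℝ → F} (hf : ContDiff ℝ ∞ f) :
    ContDiff ℝ ∞ (fun p => ∫ s in (0 : ℝ)..1, f (p, s)) := by
  let J : C(𝕀, F) →L[ℝ] F :=
    LinearMap.mkContinuous
      { toFun := fun g => ∫ s in (0 : ℝ)..1, g (toUnit s)
        map_add' := fun f g => by
          simp only [ContinuousMap.add_apply]
          exact intervalIntegral.integral_add (Continuous.intervalIntegrable (by fun_prop) _ _)
            (Continuous.intervalIntegrable (by fun_prop) _ _)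
        map_smul' := fun r g => by simp } 1
      (fun g => by
        rw [one_mul]
        refine (intervalIntegral.norm_integral_le_of_norm_le_const
          (fun r _ => g.norm_coe_le_norm _)).trans ?_
        simp)
  convert J.contDiff.comp (contDiff_curry_unit hf) using 2 with p
  refine intervalIntegral.integral_congr fun s hs => ?_
  rw [uIcc_of_le zero_le_one] at hs
  change _ = f (p, (toUnit s : ℝ))
  rw [coe_toUnit hs]

/-- Substituting s = τ(p)r moves the variable endpoint into the integrand. -/
theorem contDiff_parametric_intervalIntegral [CompleteSpace F] {f : P × ℝ → F}
    (hf : ContDiff ℝ ∞ f) {τ : P → ℝ} (hτ : ContDiff ℝ ∞ τ) :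
    ContDiff ℝ ∞ (fun p => ∫ s in (0 : ℝ)..τ p, f (p, s)) := by
  have h : (fun p => ∫ s in (0 : ℝ)..τ p, f (p, s)) =
      fun p => τ p • ∫ s in (0 : ℝ)..1, f (p, τ p * s) := by
    funext p
    rw [intervalIntegral.smul_integral_comp_mul_left (fun s => f (p, s)), mul_zero, mul_one]
  rw [h]
  exact hτ.smul (contDiff_integral_unit (f := fun q : P × ℝ => f (q.1, τ q.1 * q.2)) (by fun_prop))

end Volterra

/-! ### Flows and linear transport equations -/

section Transport

variable {E : Type} [NormedAddCommGroup E] [NormedSpace ℝ E] [CompleteSpace E]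

/-- The flow equation in integral form is a Volterra equation. Compact support makes V globally
Lipschitz, which gives existence for all times, and ODE uniqueness gives the group law. -/
theorem exists_contDiff_flow {V : E → E} (hV : ContDiff ℝ ∞ V) (hc : HasCompactSupport V) :
    ∃ φ : E × ℝ → E, ContDiff ℝ ∞ φ ∧ (∀ x, φ (x, 0) = x) ∧
      (∀ x t, HasDerivAt (fun t => φ (x, t)) (V (φ (x, t))) t) ∧
      ∀ x r s, φ (φ (x, r), s) = φ (x, r + s) := by
  obtain ⟨L, hL⟩ := hV.lipschitzWith_of_hasCompactSupport hc (by simp)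
  obtain ⟨φ, hφ, heq⟩ := exists_contDiff_volterra_real (P := E)
    (Φ := fun q => V q.2.2.2) (R := fun q => q.1) (by fun_prop) (by fun_prop)
    (fun p M => ⟨L, L.2, fun t s _ _ v w => hL.norm_sub_le v w⟩)
  have h0 : ∀ x, φ (x, 0) = x := fun x => by simp [heq x 0]
  have hd : ∀ x t, HasDerivAt (fun t => φ (x, t)) (V (φ (x, t))) t := by
    intro x t
    have hcont : Continuous fun s => V (φ (x, s)) := by
      have := hφ.continuous
      have := hV.continuous
      fun_prop
    have h := (hcont.integral_hasStrictDerivAt 0 t).hasDerivAt.const_add x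
    exact h.congr_of_eventuallyEq (Eventually.of_forall fun s => heq x s)
  refine ⟨φ, hφ, h0, hd, fun x r s => ?_⟩
  refine congrFun (ODE_solution_unique_univ (v := fun _ => V) (s := fun _ => univ) (K := L)
    (t₀ := 0) (f := fun s => φ (φ (x, r), s)) (g := fun s => φ (x, r + s))
    (fun _ => hL.lipschitzOnWith) (fun s => ⟨hd _ _, mem_univ _⟩)
    (fun s => ⟨(hd x (r + s)).comp_const_add r s, mem_univ _⟩) (by simp [h0])) s

theorem fderiv_prod_apply {X : Type} [NormedAddCommGroup X] [NormedSpace ℝ X] {F : Type} [NormedAddCommGroup F] [NormedSpace ℝ F] {f : X × ℝ → F}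
    {x : X} {t : ℝ} (hf : DifferentiableAt ℝ f (x, t)) (v : X) (τ : ℝ) :
    fderiv ℝ f (x, t) (v, τ) =
      fderiv ℝ (fun y => f (y, t)) x v + τ • deriv (fun s => f (x, s)) t := by
  have h1 : HasFDerivAt (fun y => f (y, t)) (fderiv ℝ f (x, t) ∘L .inl ℝ X ℝ) x :=
    hf.hasFDerivAt.comp x (hasFDerivAt_prodMk_left x t)
  have h2 : HasFDerivAt (fun s => f (x, s)) (fderiv ℝ f (x, t) ∘L .inr ℝ X ℝ) t :=
    hf.hasFDerivAt.comp t (hasFDerivAt_prodMk_right x t)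
  rw [h1.fderiv, ← fderiv_apply_one_eq_deriv, h2.fderiv, ← map_smul]
  simp only [ContinuousLinearMap.comp_apply, ContinuousLinearMap.inl_apply,
    ContinuousLinearMap.inr_apply, ← map_add]
  simp

/-- Method of characteristics: along an integral curve starting at y the equation is a linear ODE,
solved by g(y, ·) with integrating factor exp B and zero initial value. The solution at (x, t) is g
at the foot φ(x, -t) of the characteristic. -/
theorem exists_contDiff_transport_of_hasCompactSupport {V : E → E} (hV : ContDiff ℝ ∞ V)
    (hc : HasCompactSupport V) {β : E → ℝ} (hβ : ContDiff ℝ ∞ β) {f : E × ℝ → ℂ}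
    (hf : ContDiff ℝ ∞ f) :
    ∃ a : E × ℝ → ℂ, ContDiff ℝ ∞ a ∧ ∀ x t,
      deriv (fun s => a (x, s)) t + fderiv ℝ (fun y => a (y, t)) x (V x) + β x * a (x, t) =
        f (x, t) := by
  obtain ⟨φ, hφ, h0, hd, hgrp⟩ := exists_contDiff_flow hV hc
  let B : E × ℝ → ℂ := fun q => ∫ r in (0 : ℝ)..q.2, (β (φ (q.1, r)) : ℂ)
  have hβ' : ContDiff ℝ ∞ fun q : E × ℝ => (β (φ q) : ℂ) :=
    Complex.ofRealCLM.contDiff.comp (hβ.comp hφ)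
  have hB : ContDiff ℝ ∞ B :=
    contDiff_parametric_intervalIntegral (f := fun q : (E × ℝ) × ℝ => (β (φ (q.1.1, q.2)) : ℂ))
      (hβ'.comp (by fun_prop)) contDiff_snd
  let S : E × ℝ → ℂ := fun q => ∫ s in (0 : ℝ)..q.2, Complex.exp (B (q.1, s)) * f (φ (q.1, s), s)
  have hS : ContDiff ℝ ∞ S :=
    contDiff_parametric_intervalIntegral
      (f := fun q : (E × ℝ) × ℝ => Complex.exp (B (q.1.1, q.2)) * f (φ (q.1.1, q.2), q.2))
      (by fun_prop) contDiff_snd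
  let g : E × ℝ → ℂ := fun q => Complex.exp (-B q) * S q
  have hg : ContDiff ℝ ∞ g := by fun_prop
  have hgd : ∀ y t, HasDerivAt (fun s => g (y, s))
      (f (φ (y, t), t) - β (φ (y, t)) * g (y, t)) t := by
    intro y t
    have hBd : HasDerivAt (fun s => B (y, s)) (β (φ (y, t)) : ℂ) t := by
      have := hβ'.continuous
      exact (Continuous.integral_hasStrictDerivAt (f := fun r => (β (φ (y, r)) : ℂ))
        (by fun_prop) 0 t).hasDerivAt
    have hSd : HasDerivAt (fun s => S (y, s)) (Complex.exp (B (y, t)) * f (φ (y, t), t)) t := by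
      have := hB.continuous
      have := hf.continuous
      have := hφ.continuous
      exact (Continuous.integral_hasStrictDerivAt
        (f := fun s => Complex.exp (B (y, s)) * f (φ (y, s), s)) (by fun_prop) 0 t).hasDerivAt
    refine ((hBd.neg.cexp).mul hSd).congr_deriv ?_
    have : Complex.exp (-B (y, t)) * Complex.exp (B (y, t)) = 1 := by simp [← Complex.exp_add]
    simp only [g, Pi.neg_apply]
    linear_combination f (φ (y, t), t) * this
  refine ⟨fun q => g (φ (q.1, -q.2), q.2), by fun_prop, fun x t => ?_⟩
  set a : E × ℝ → ℂ := fun q => g (φ (q.1, -q.2), q.2) with ha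
  have had : ContDiff ℝ ∞ a := by fun_prop
  have hcurve : HasDerivAt (fun r => (φ (x, r), t + r)) ((V x, 1) : E × ℝ) 0 := by
    have h : HasDerivAt (fun r => φ (x, r)) (V x) 0 := by simpa [h0] using hd x 0
    have h' : HasDerivAt (fun r : ℝ => t + r) 1 0 := (hasDerivAt_id (0 : ℝ)).const_add t
    exact h.prodMk h'
  have h1 : HasDerivAt (fun r => a (φ (x, r), t + r)) (fderiv ℝ a (x, t) (V x, 1)) 0 := by
    have h : HasFDerivAt a (fderiv ℝ a (x, t)) (φ (x, 0), t + 0) := by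
      simpa [h0] using ((had.differentiable (by simp)) (x, t)).hasFDerivAt
    exact h.comp_hasDerivAt (0 : ℝ) hcurve
  -- All points (φ(x, r), t + r) lie on one characteristic, hence share the foot φ(x, -t). The
  -- derivative of a along it, computed by the chain rule and by the ODE for g, gives the equation.
  have h2 : (fun r => a (φ (x, r), t + r)) = fun r => g (φ (x, -t), t + r) := by
    funext r
    simp only [ha, hgrp]
    congr 4
    ring
  have h3 : HasDerivAt (fun r => g (φ (x, -t), t + r)) (f (x, t) - β x * a (x, t)) 0 := by
    have h := hgd (φ (x, -t)) (t + 0)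
    have h' := h.comp_const_add t 0
    simpa [hgrp, h0, ha] using h'
  rw [h2] at h1
  have h4 := h1.unique h3
  rw [fderiv_prod_apply ((had.differentiable (by simp)) _)] at h4
  rw [one_smul] at h4
  linear_combination h4

theorem exists_contDiff_eq_one_of_isBounded {X : Type} [NormedAddCommGroup X] [NormedSpace ℝ X]
    [FiniteDimensional ℝ X] {Ω : Set X} (hΩ : Bornology.IsBounded Ω) :
    ∃ χ : X → ℝ, ContDiff ℝ ∞ χ ∧ HasCompactSupport χ ∧ ∀ x ∈ Ω, χ x = 1 := by
  obtain ⟨r, hr⟩ := hΩ.subset_closedBall 0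
  let χ : ContDiffBump (0 : X) := ⟨max r 1, max r 1 + 1, by positivity, by linarith⟩
  refine ⟨χ, χ.contDiff, χ.hasCompactSupport, fun x hx => χ.one_of_mem_closedBall ?_⟩
  exact Metric.closedBall_subset_closedBall (le_max_left r 1) (hr hx)

/-- The equation at x involves V only through V x, so V may be multiplied by a cutoff equal to one
on Ω. -/
theorem exists_contDiff_transport {X : Type} [NormedAddCommGroup X] [NormedSpace ℝ X]
    [FiniteDimensional ℝ X] {Ω : Set X} (hΩ : Bornology.IsBounded Ω)
    {V : X → X} (hV : ContDiff ℝ ∞ V) {β : X → ℝ} (hβ : ContDiff ℝ ∞ β) {f : X × ℝ → ℂ}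
    (hf : ContDiff ℝ ∞ f) :
    ∃ a : X × ℝ → ℂ, ContDiff ℝ ∞ a ∧ ∀ x ∈ Ω, ∀ t,
      deriv (fun s => a (x, s)) t + fderiv ℝ (fun y => a (y, t)) x (V x) + β x * a (x, t) =
        f (x, t) := by
  obtain ⟨χ, hχ, hχc, hχ1⟩ := exists_contDiff_eq_one_of_isBounded hΩ
  have := FiniteDimensional.complete ℝ X
  obtain ⟨a, ha, h⟩ := exists_contDiff_transport_of_hasCompactSupport (hχ.smul hV)
    hχc.smul_right hβ hf
  refine ⟨a, ha, fun x hx t => ?_⟩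
  simpa [hχ1 x hx] using h x t

end Transport

/-! ### Joint smoothness of all operators, and solvability of the two model equations -/

section Smoothness

variable {n : ℕ} {P : Type} [NormedAddCommGroup P] [NormedSpace ℝ P]
  {F : Type} [NormedAddCommGroup F] [NormedSpace ℝ F]

theorem SmoothST.comp {f : Space n → ℝ → F} (hf : SmoothST f) {x : P → Space n} {t : P → ℝ}
    (hx : ContDiff ℝ ∞ x) (ht : ContDiff ℝ ∞ t) : ContDiff ℝ ∞ (fun p => f (x p) (t p)) :=
  ContDiff.comp (g := fun p : Space n × ℝ => f p.1 p.2) hf (hx.prodMk ht)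

theorem contDiff_ofReal {f : P → ℝ} (hf : ContDiff ℝ ∞ f) :
    ContDiff ℝ ∞ (fun p => (f p : ℂ)) :=
  Complex.ofRealCLM.contDiff.comp hf

theorem contDiff_pderiv {f : P → Space n → F} (hf : ContDiff ℝ ∞ (fun q : P × Space n => f q.1 q.2))
    {x : P → Space n} (hx : ContDiff ℝ ∞ x) (j : Fin n) :
    ContDiff ℝ ∞ (fun p => pderiv j (f p) (x p)) :=
  (ContDiff.fderiv (n := ∞) (f := f) hf hx (by simp)).clm_apply contDiff_const

theorem contDiff_divGrad {κ : P → Space n → ℝ} {f : P → Space n → F}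
    (hκ : ContDiff ℝ ∞ (fun q : P × Space n => κ q.1 q.2))
    (hf : ContDiff ℝ ∞ (fun q : P × Space n => f q.1 q.2))
    {x : P → Space n} (hx : ContDiff ℝ ∞ x) :
    ContDiff ℝ ∞ (fun p => divGrad (κ p) (f p) (x p)) := by
  refine ContDiff.sum fun j _ => contDiff_pderiv (hκ.smul ?_) hx j
  exact contDiff_pderiv (P := P × Space n) (f := fun q => f q.1)
    (hf.comp (by fun_prop : ContDiff ℝ ∞ fun q : (P × Space n) × Space n => (q.1.1, q.2)))
    contDiff_snd j

theorem contDiff_gradient {ψ : Space n → ℝ} (hψ : ContDiff ℝ ∞ ψ) :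
    ContDiff ℝ ∞ (gradient ψ) :=
  (InnerProductSpace.toDual ℝ (Space n)).symm.contDiff.comp (hψ.fderiv_right (by simp))

theorem contDiff_gradDot {ψ : Space n → ℝ} (hψ : ContDiff ℝ ∞ ψ) {a : Space n → ℝ → ℂ}
    (ha : SmoothST a) {x : P → Space n} {t : P → ℝ} (hx : ContDiff ℝ ∞ x) (ht : ContDiff ℝ ∞ t) :
    ContDiff ℝ ∞ (fun p => gradDot ψ a (x p) (t p)) := by
  have h : ContDiff ℝ ∞ fun q : P × Space n => a q.2 (t q.1) :=
    ha.comp contDiff_snd (ht.comp contDiff_fst)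
  exact (ContDiff.fderiv (n := ∞) (f := fun p y => a y (t p)) h hx (by simp)).clm_apply
    ((contDiff_gradient hψ).comp hx)

theorem contDiff_deriv {f : P → ℝ → F} (hf : ContDiff ℝ ∞ (fun q : P × ℝ => f q.1 q.2))
    {τ : P → ℝ} (hτ : ContDiff ℝ ∞ τ) : ContDiff ℝ ∞ (fun p => deriv (f p) (τ p)) := by
  simp only [← fderiv_apply_one_eq_deriv]
  exact (ContDiff.fderiv (n := ∞) (f := f) hf hτ (by simp)).clm_apply contDiff_const

theorem contDiff_iteratedDeriv {f : P → ℝ → F}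
    (hf : ContDiff ℝ ∞ (fun q : P × ℝ => f q.1 q.2))
    {τ : P → ℝ} (hτ : ContDiff ℝ ∞ τ) (m : ℕ) :
    ContDiff ℝ ∞ (fun p => iteratedDeriv m (f p) (τ p)) := by
  have h : ContDiff ℝ ∞ (fun q : P × ℝ => iteratedDeriv m (f q.1) q.2) := by
    induction m with
    | zero => simpa using hf
    | succ m ih =>
      simp only [iteratedDeriv_succ]
      exact contDiff_deriv (P := P × ℝ) (f := fun q => iteratedDeriv m (f q.1))
        (ih.comp (by fun_prop : ContDiff ℝ ∞ fun q : (P × ℝ) × ℝ => (q.1.1, q.2))) contDiff_snd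
  exact h.comp (contDiff_id.prodMk hτ)

variable {c : Space n → ℝ} {G : Space n → ℝ → ℝ} {ψ : Space n → ℝ} {a : Space n → ℝ → ℂ}
  {x : P → Space n} {t s : P → ℝ}

theorem contDiff_memA (hc : ContDiff ℝ ∞ c) (hc0 : ∀ x, 0 < c x) (hG : SmoothST G)
    (ha : SmoothST a) (hx : ContDiff ℝ ∞ x) (ht : ContDiff ℝ ∞ t) (hs : ContDiff ℝ ∞ s) :
    ContDiff ℝ ∞ (fun p => memA c G a (x p) (t p) (s p)) := by
  unfold memA
  exact (contDiff_const.mul (contDiff_ofReal (((hc.comp hx).inv fun p => (hc0 _).ne').mul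
    (hG.comp hx (ht.sub hs))))).mul (ha.comp hx hs)

theorem contDiff_divGrad_kernel {f : Space n → ℝ → F} (hG : SmoothST G) (hf : SmoothST f)
    (hx : ContDiff ℝ ∞ x) (ht : ContDiff ℝ ∞ t) (hs : ContDiff ℝ ∞ s) :
    ContDiff ℝ ∞ (fun p => divGrad (fun y => G y (t p)) (fun y => f y (s p)) (x p)) :=
  contDiff_divGrad (κ := fun p y => G y (t p)) (f := fun p y => f y (s p))
    (hG.comp contDiff_snd (ht.comp contDiff_fst)) (hf.comp contDiff_snd (hs.comp contDiff_fst)) hx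

theorem smoothST_of_contDiff {f : Space n → F} (hf : ContDiff ℝ ∞ f) :
    SmoothST (fun x (_ : ℝ) => f x) :=
  hf.comp contDiff_fst

theorem contDiff_memB (hG : SmoothST G) (hψ : ContDiff ℝ ∞ ψ)
    (ha : SmoothST a) (hx : ContDiff ℝ ∞ x) (ht : ContDiff ℝ ∞ t) (hs : ContDiff ℝ ∞ s) :
    ContDiff ℝ ∞ (fun p => memB G ψ a (x p) (t p) (s p)) := by
  unfold memB
  have h1 : ContDiff ℝ ∞ fun p => divGrad (fun y => G y (t p - s p)) ψ (x p) :=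
    contDiff_divGrad_kernel hG (smoothST_of_contDiff hψ) hx (ht.sub hs) hs
  exact contDiff_const.mul (((contDiff_const.mul (contDiff_ofReal (hG.comp hx (ht.sub hs)))).mul
    (contDiff_gradDot hψ ha hx hs)).add ((contDiff_ofReal h1).mul (ha.comp hx hs)))

theorem contDiff_memC (hG : SmoothST G)
    (ha : SmoothST a) (hx : ContDiff ℝ ∞ x) (ht : ContDiff ℝ ∞ t) (hs : ContDiff ℝ ∞ s) :
    ContDiff ℝ ∞ (fun p => memC G a (x p) (t p) (s p)) :=
  contDiff_const.mul (contDiff_divGrad_kernel hG ha hx (ht.sub hs) hs)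

theorem smoothST_divGrad {f : Space n → ℝ → F} (hc : ContDiff ℝ ∞ c) (hf : SmoothST f) :
    SmoothST (fun x t => divGrad c (fun y => f y t) x) :=
  contDiff_divGrad_kernel (smoothST_of_contDiff hc) hf contDiff_fst contDiff_snd contDiff_snd

theorem contDiff_divGrad_of_contDiff (hc : ContDiff ℝ ∞ c) (hψ : ContDiff ℝ ∞ ψ) :
    ContDiff ℝ ∞ (divGrad c ψ) :=
  contDiff_divGrad (κ := fun _ : Space n => c) (f := fun _ => ψ) (hc.comp contDiff_snd)
    (hψ.comp contDiff_snd) contDiff_id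

theorem smoothST_waveOp (hc : ContDiff ℝ ∞ c) (ha : SmoothST a) : SmoothST (waveOp c a) := by
  refine contDiff_const.mul (ContDiff.sub ?_ (smoothST_divGrad hc ha))
  exact contDiff_iteratedDeriv (f := fun (q : Space n × ℝ) τ => a q.1 τ)
    (ha.comp (by fun_prop) (by fun_prop)) contDiff_snd 2

theorem smoothST_memoryOp (hG : SmoothST G) (ha : SmoothST a) : SmoothST (memoryOp G a) := by
  refine contDiff_const.mul (contDiff_parametric_intervalIntegral
    (f := fun q : (Space n × ℝ) × ℝ =>
      divGrad (fun y => G y (q.1.2 - q.2)) (fun y => a y q.2) q.1.1) ?_ contDiff_snd)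
  exact contDiff_divGrad_kernel hG ha (by fun_prop) (by fun_prop) (by fun_prop)

theorem smoothST_viscoOp (hc : ContDiff ℝ ∞ c) (hG : SmoothST G) (ha : SmoothST a) :
    SmoothST (viscoOp c G a) :=
  (smoothST_waveOp hc ha).add (smoothST_memoryOp hG ha)

theorem smoothST_firstOrderOp (hc : ContDiff ℝ ∞ c) (hG : SmoothST G) (hψ : ContDiff ℝ ∞ ψ)
    (ha : SmoothST a) : SmoothST (firstOrderOp c G ψ a) := by
  have h1 : ContDiff ℝ ∞ fun q : Space n × ℝ => (c q.1 : ℂ) :=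
    contDiff_ofReal (hc.comp contDiff_fst)
  have h2 : ContDiff ℝ ∞ fun q : Space n × ℝ => ((divGrad c ψ q.1 : ℝ) : ℂ) :=
    contDiff_ofReal ((contDiff_divGrad_of_contDiff hc hψ).comp contDiff_fst)
  refine ((h1.mul (contDiff_gradDot hψ ha contDiff_fst contDiff_snd)).add
    ((contDiff_const.mul h2).mul ha)).add ?_
  exact contDiff_parametric_intervalIntegral
    (f := fun q : (Space n × ℝ) × ℝ => memB G ψ a q.1.1 q.1.2 q.2)
    (contDiff_memB hG hψ ha (by fun_prop) (by fun_prop) (by fun_prop)) contDiff_snd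

theorem contDiff_iteratedDeriv_kernel {M : Space n → ℝ → ℝ → ℂ}
    (hM : ContDiff ℝ ∞ fun q : (Space n × ℝ) × ℝ => M q.1.1 q.1.2 q.2) (m : ℕ)
    (hx : ContDiff ℝ ∞ x) (ht : ContDiff ℝ ∞ t) (hs : ContDiff ℝ ∞ s) :
    ContDiff ℝ ∞ (fun p => iteratedDeriv m (fun s => M (x p) (t p) s) (s p)) :=
  contDiff_iteratedDeriv (f := fun p s => M (x p) (t p) s)
    (hM.comp (by fun_prop : ContDiff ℝ ∞ fun q : P × ℝ => ((x q.1, t q.1), q.2))) hs m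

theorem contDiff_iteratedDeriv_memA (hc : ContDiff ℝ ∞ c) (hc0 : ∀ x, 0 < c x) (hG : SmoothST G)
    (ha : SmoothST a) (m : ℕ) (hx : ContDiff ℝ ∞ x) (ht : ContDiff ℝ ∞ t) (hs : ContDiff ℝ ∞ s) :
    ContDiff ℝ ∞ (fun p => iteratedDeriv m (fun s => memA c G a (x p) (t p) s) (s p)) :=
  contDiff_iteratedDeriv_kernel
    (contDiff_memA hc hc0 hG ha (by fun_prop) (by fun_prop) (by fun_prop)) m hx ht hs

theorem contDiff_iteratedDeriv_memB (hG : SmoothST G) (hψ : ContDiff ℝ ∞ ψ)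
    (ha : SmoothST a) (m : ℕ) (hx : ContDiff ℝ ∞ x) (ht : ContDiff ℝ ∞ t) (hs : ContDiff ℝ ∞ s) :
    ContDiff ℝ ∞ (fun p => iteratedDeriv m (fun s => memB G ψ a (x p) (t p) s) (s p)) :=
  contDiff_iteratedDeriv_kernel
    (contDiff_memB hG hψ ha (by fun_prop) (by fun_prop) (by fun_prop)) m hx ht hs

theorem contDiff_iteratedDeriv_memC (hG : SmoothST G)
    (ha : SmoothST a) (m : ℕ) (hx : ContDiff ℝ ∞ x) (ht : ContDiff ℝ ∞ t) (hs : ContDiff ℝ ∞ s) :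
    ContDiff ℝ ∞ (fun p => iteratedDeriv m (fun s => memC G a (x p) (t p) s) (s p)) :=
  contDiff_iteratedDeriv_kernel
    (contDiff_memC hG ha (by fun_prop) (by fun_prop) (by fun_prop)) m hx ht hs

theorem smoothST_transportSource (hc : ContDiff ℝ ∞ c) (hc0 : ∀ x, 0 < c x) (hG : SmoothST G)
    (hψ : ContDiff ℝ ∞ ψ) {a : ℕ → Space n → ℝ → ℂ} (l : ℕ) (ha : ∀ m < l, SmoothST (a m)) :
    SmoothST (transportSource c G ψ a l) := by
  cases l with
  | zero => exact contDiff_const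
  | succ l =>
    refine contDiff_const.mul (((smoothST_waveOp hc (ha l (by lia))).sub
      (ContDiff.sum fun m hm => ContDiff.add ?_ ?_)).sub (ContDiff.sum fun m hm => ?_))
    · exact contDiff_iteratedDeriv_memA hc hc0 hG (ha m (by simpa using hm)) _ contDiff_fst
        contDiff_snd contDiff_snd
    · exact contDiff_iteratedDeriv_memB hG hψ (ha m (by simpa using hm)) _ contDiff_fst
        contDiff_snd contDiff_snd
    · exact contDiff_iteratedDeriv_memC hG (ha m (by have := Finset.mem_range.1 hm; lia)) _
        contDiff_fst contDiff_snd contDiff_snd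

theorem smoothST_volterraLower (hc : ContDiff ℝ ∞ c) (hG : SmoothST G)
    (hψ : ContDiff ℝ ∞ ψ) {a : ℕ → Space n → ℝ → ℂ} (l : ℕ) (ha : ∀ m < l, SmoothST (a m)) :
    SmoothST (volterraLower c G ψ a l) := by
  match l with
  | 0 => exact contDiff_const
  | 1 => exact smoothST_firstOrderOp hc hG hψ (ha 0 (by lia))
  | l + 2 =>
    exact (smoothST_firstOrderOp hc hG hψ (ha (l + 1) (by lia))).add
      (smoothST_viscoOp hc hG (ha l (by lia)))

theorem smoothST_volterraSource (hc : ContDiff ℝ ∞ c) (hc0 : ∀ x, 0 < c x) (hG : SmoothST G)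
    (hψ : ContDiff ℝ ∞ ψ) {a' a'' : ℕ → Space n → ℝ → ℂ} (l : ℕ) (ha' : ∀ m, SmoothST (a' m))
    (ha'' : ∀ m < l, SmoothST (a'' m)) :
    SmoothST (volterraSource c G ψ a' a'' l) := by
  refine contDiff_const.mul ((((smoothST_volterraLower hc hG hψ l ha'').add
    (ContDiff.sum fun m _ => ?_)).add (ContDiff.sum fun m _ => ?_)).add
      (ContDiff.sum fun m _ => ?_))
  · exact contDiff_iteratedDeriv_memA hc hc0 hG (ha' m) _ contDiff_fst contDiff_snd contDiff_const
  · exact contDiff_iteratedDeriv_memB hG hψ (ha' m) _ contDiff_fst contDiff_snd contDiff_const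
  · exact contDiff_iteratedDeriv_memC hG (ha' m) _ contDiff_fst contDiff_snd contDiff_const

theorem exists_volterraOp_eq (hc : ContDiff ℝ ∞ c) (hc0 : ∀ x, 0 < c x) (hG : SmoothST G)
    {f : Space n → ℝ → ℂ} (hf : SmoothST f) :
    ∃ a : Space n → ℝ → ℂ, SmoothST a ∧ ∀ x t, volterraOp c G a x t = f x t := by
  have hk : ContDiff ℝ ∞ fun q : Space n × ℝ => (((c q.1)⁻¹ * G q.1 q.2 : ℝ) : ℂ) :=
    contDiff_ofReal (((hc.comp contDiff_fst).inv fun q => (hc0 _).ne').mul hG)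
  obtain ⟨u, hu, h⟩ := exists_contDiff_volterra_real (P := Space n) (E := ℂ)
    (Φ := fun q => (((c q.1)⁻¹ * G q.1 (q.2.1 - q.2.2.1) : ℝ) : ℂ) * q.2.2.2)
    (R := fun q => f q.1 q.2)
    ((hk.comp (by fun_prop : ContDiff ℝ ∞ fun q : Space n × ℝ × ℝ × ℂ =>
      (q.1, q.2.1 - q.2.2.1))).mul (by fun_prop)) hf (by
      intro x M
      -- For |t|, |s| ≤ M the kernel is evaluated at t - s, which stays in [-2M, 2M].
      obtain ⟨L, hL⟩ := (isCompact_Icc (a := -(2 * M)) (b := 2 * M)).exists_bound_of_continuousOn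
        (f := fun s => (((c x)⁻¹ * G x s : ℝ) : ℂ))
        (hk.continuous.comp (by fun_prop : Continuous fun s : ℝ => (x, s))).continuousOn
      refine ⟨max L 0, le_max_right _ _, fun t s ht hs v w => ?_⟩
      simp only [← mul_sub, norm_mul]
      refine mul_le_mul_of_nonneg_right ?_ (norm_nonneg _)
      rw [abs_le] at ht hs
      exact (hL (t - s) ⟨by linarith, by linarith⟩).trans (le_max_left _ _))
  refine ⟨fun x t => u (x, t), hu, fun x t => ?_⟩
  rw [volterraOp, h x t]
  ring

theorem exists_transportOp_eq {Ω : Set (Space n)} (hΩ : Bornology.IsBounded Ω)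
    (hc : ContDiff ℝ ∞ c) (hc0 : ∀ x, 0 < c x) (hG : SmoothST G)
    (hψ : ContDiff ℝ ∞ ψ) {f : Space n → ℝ → ℂ} (hf : SmoothST f) :
    ∃ a : Space n → ℝ → ℂ, SmoothST a ∧ ∀ x ∈ Ω, ∀ t, transportOp c G ψ a x t = f x t := by
  have hb : ContDiff ℝ ∞ fun x => (1 / 2 : ℝ) * transportCoeff c G ψ x := by
    refine contDiff_const.mul (ContDiff.add ?_ (contDiff_divGrad_of_contDiff hc hψ))
    exact (hc.inv fun x => (hc0 x).ne').mul (hG.comp contDiff_id contDiff_const)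
  -- The transport equation divided by two, to normalise the coefficient of ∂_t.
  obtain ⟨a, ha, h⟩ := exists_contDiff_transport hΩ (V := fun x => c x • gradient ψ x)
    (hc.smul (contDiff_gradient hψ)) hb (f := fun q => (1 / 2 : ℂ) * f q.1 q.2)
    (contDiff_const.mul hf)
  refine ⟨fun x t => a (x, t), ha, fun x hx t => ?_⟩
  have h1 := h x hx t
  simp only [map_smul, Complex.real_smul] at h1
  push_cast at h1
  rw [transportOp, gradDot]
  linear_combination 2 * h1

end Smoothness

/-- Recursive construction of a sequence whose `l`-th term is constrained by the earlier ones. -/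
theorem exists_seq_of_forall_exists {α : Type} [Inhabited α] (p : (ℕ → α) → ℕ → α → Prop)
    (hp : ∀ a b l y, (∀ m < l, a m = b m) → p a l y → p b l y)
    (good : α → Prop) (h : ∀ a l, (∀ m < l, good (a m)) → ∃ y, good y ∧ p a l y) :
    ∃ a : ℕ → α, ∀ l, good (a l) ∧ p a l (a l) := by
  classical
  have h' : ∀ a l, ∃ y, (∀ m < l, good (a m)) → good y ∧ p a l y := by
    intro a l
    by_cases hg : ∀ m < l, good (a m)
    · obtain ⟨y, hy⟩ := h a l hg
      exact ⟨y, fun _ => hy⟩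
    · exact ⟨default, fun hg' => absurd hg' hg⟩
  choose next hnext using h'
  -- The l-th table holds the terms of index below l and default values elsewhere; these defaults
  -- are harmless because p at stage l reads only earlier terms.
  let table : ℕ → ℕ → α := fun l =>
    Nat.rec (fun _ => default) (fun l b => Function.update b l (next b l)) l
  have htable : ∀ l m, m < l → table l m = next (table m) m := by
    intro l
    induction l with
    | zero => intro m hm; lia
    | succ l ih =>
      intro m hm
      change Function.update (table l) l (next (table l) l) m = _
      rcases Nat.lt_succ_iff_lt_or_eq.1 hm with hm | rfl
      · rw [Function.update_of_ne hm.ne, ih m hm]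
      · rw [Function.update_self]
  have hgood : ∀ l, good (next (table l) l) ∧ p (table l) l (next (table l) l) := by
    intro l
    induction l using Nat.strong_induction_on with
    | _ l ih =>
      refine hnext (table l) l fun m hm => ?_
      rw [htable l m hm]
      exact (ih m hm).1
  exact ⟨fun l => next (table l) l, fun l => ⟨(hgood l).1,
    hp _ _ l _ (fun m hm => htable l m hm) (hgood l).2⟩⟩

/-! ### Recursive construction of the two families of amplitudes -/

section Amplitudes

variable {n : ℕ} {c : Space n → ℝ} {G : Space n → ℝ → ℝ} {ψ : Space n → ℝ}

theorem transportSource_congr {a b : ℕ → Space n → ℝ → ℂ} {l : ℕ} (h : ∀ m < l, a m = b m) :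
    transportSource c G ψ a l = transportSource c G ψ b l := by
  cases l with
  | zero => rfl
  | succ l =>
    funext x t
    simp only [transportSource]
    rw [h l (by lia)]
    congr 2
    · congr 1
      refine Finset.sum_congr rfl fun m hm => ?_
      rw [h m (by simpa using hm)]
    · refine Finset.sum_congr rfl fun m hm => ?_
      rw [h m (by have := Finset.mem_range.1 hm; lia)]

theorem volterraSource_congr {a' a b : ℕ → Space n → ℝ → ℂ} {l : ℕ} (h : ∀ m < l, a m = b m) :
    volterraSource c G ψ a' a l = volterraSource c G ψ a' b l := by
  have : volterraLower c G ψ a l = volterraLower c G ψ b l := by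
    match l with
    | 0 => rfl
    | 1 => funext x t; simp only [volterraLower, h 0 (by lia)]
    | l + 2 => funext x t; simp only [volterraLower, h l (by lia), h (l + 1) (by lia)]
  funext x t
  simp only [volterraSource, this]

theorem exists_transport_amplitudes {Ω : Set (Space n)} (hΩ : Bornology.IsBounded Ω)
    (hc : ContDiff ℝ ∞ c) (hc0 : ∀ x, 0 < c x) (hG : SmoothST G)
    (hψ : ContDiff ℝ ∞ ψ) {a₀ : Space n → ℝ → ℂ} (ha₀ : SmoothST a₀) :
    ∃ a : ℕ → Space n → ℝ → ℂ, a 0 = a₀ ∧ (∀ l, SmoothST (a l)) ∧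
      ∀ l, ∀ x ∈ Ω, ∀ t,
        transportOp c G ψ (a (l + 1)) x t = transportSource c G ψ a (l + 1) x t := by
  obtain ⟨a, ha⟩ := exists_seq_of_forall_exists (α := Space n → ℝ → ℂ)
    -- Stage zero only pins the given amplitude; its own transport equation plays no role in the
    -- recursion.
    (fun a l y => (l = 0 → y = a₀) ∧
      (l ≠ 0 → ∀ x ∈ Ω, ∀ t, transportOp c G ψ y x t = transportSource c G ψ a l x t))
    (fun a b l y hab => by rw [transportSource_congr hab]; exact id) SmoothST (by
      intro a l hl
      rcases eq_or_ne l 0 with rfl | hl0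
      · exact ⟨a₀, ha₀, by simp⟩
      · obtain ⟨y, hy, h⟩ := exists_transportOp_eq hΩ hc hc0 hG hψ
          (smoothST_transportSource hc hc0 hG hψ l hl)
        exact ⟨y, hy, by simp [hl0], fun _ => h⟩)
  exact ⟨a, (ha 0).2.1 rfl, fun l => (ha l).1, fun l => (ha (l + 1)).2.2 (by simp)⟩

theorem exists_volterra_amplitudes
    (hc : ContDiff ℝ ∞ c) (hc0 : ∀ x, 0 < c x) (hG : SmoothST G)
    (hψ : ContDiff ℝ ∞ ψ) {a' : ℕ → Space n → ℝ → ℂ} (ha' : ∀ l, SmoothST (a' l)) :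
    ∃ a : ℕ → Space n → ℝ → ℂ, (∀ l, SmoothST (a l)) ∧
      ∀ l x t, volterraOp c G (a l) x t = volterraSource c G ψ a' a l x t := by
  obtain ⟨a, ha⟩ := exists_seq_of_forall_exists (α := Space n → ℝ → ℂ)
    (fun a l y => ∀ x t, volterraOp c G y x t = volterraSource c G ψ a' a l x t)
    (fun a b l y hab => by rw [volterraSource_congr hab]; exact id) SmoothST
    (fun a l hl => exists_volterraOp_eq hc hc0 hG
      (smoothST_volterraSource hc hc0 hG hψ l ha' hl))
  exact ⟨a, fun l => (ha l).1, fun l => (ha l).2⟩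

end Amplitudes

/-! ### Conjugation of P with exp(κψ) -/

section Conjugation

variable {n : ℕ}

theorem pderiv_mul {u v : Space n → ℂ} {x : Space n} (hu : DifferentiableAt ℝ u x)
    (hv : DifferentiableAt ℝ v x) (j : Fin n) :
    pderiv j (fun y => u y * v y) x = pderiv j u x * v x + u x * pderiv j v x := by
  simp only [pderiv, fderiv_fun_mul hu hv, add_apply, smul_apply, smul_eq_mul]
  ring

theorem pderiv_add {F : Type} [NormedAddCommGroup F] [NormedSpace ℝ F] {u v : Space n → F}
    {x : Space n} (hu : DifferentiableAt ℝ u x)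
    (hv : DifferentiableAt ℝ v x) (j : Fin n) :
    pderiv j (fun y => u y + v y) x = pderiv j u x + pderiv j v x := by
  simp [pderiv, fderiv_fun_add hu hv]

theorem pderiv_const_mul {v : Space n → ℂ} {x : Space n} (hv : DifferentiableAt ℝ v x) (z : ℂ)
    (j : Fin n) : pderiv j (fun y => z * v y) x = z * pderiv j v x := by
  simp [pderiv, fderiv_const_mul hv]

theorem pderiv_ofReal {r : Space n → ℝ} {x : Space n} (hr : DifferentiableAt ℝ r x) (j : Fin n) :
    pderiv j (fun y => (r y : ℂ)) x = (pderiv j r x : ℝ) := by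
  have h := (Complex.ofRealCLM.hasFDerivAt (x := r x)).comp x hr.hasFDerivAt
  have h' : HasFDerivAt (fun y => (r y : ℂ)) (Complex.ofRealCLM ∘L fderiv ℝ r x) x := h
  simp [pderiv, h'.fderiv]

theorem pderiv_exp {r : Space n → ℝ} {x : Space n} (hr : DifferentiableAt ℝ r x) (κ : ℂ)
    (j : Fin n) : pderiv j (fun y => Complex.exp (κ * r y)) x =
      Complex.exp (κ * r x) * (κ * (pderiv j r x : ℝ)) := by
  have h' : HasFDerivAt (fun y => (r y : ℂ)) (Complex.ofRealCLM ∘L fderiv ℝ r x) x :=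
    (Complex.ofRealCLM.hasFDerivAt (x := r x)).comp x hr.hasFDerivAt
  simp [pderiv, ((h'.const_mul κ).cexp).fderiv]

theorem contDiff_pderiv_apply {F : Type} [NormedAddCommGroup F] [NormedSpace ℝ F]
    {f : Space n → F} (hf : ContDiff ℝ ∞ f) (j : Fin n) : ContDiff ℝ ∞ (pderiv j f) :=
  contDiff_pderiv (f := fun _ : Space n => f) (hf.comp contDiff_snd) contDiff_id j

theorem gradient_apply (ψ : Space n → ℝ) (x : Space n) (j : Fin n) :
    gradient ψ x j = pderiv j ψ x := by
  have h : inner ℝ (gradient ψ x) (EuclideanSpace.single j 1) = pderiv j ψ x := by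
    rw [gradient, InnerProductSpace.toDual_symm_apply]
    rfl
  rw [← h, EuclideanSpace.inner_single_right]
  simp

theorem fderiv_apply_gradient (ψ : Space n → ℝ) (a : Space n → ℂ) (x : Space n) :
    fderiv ℝ a x (gradient ψ x) = ∑ j, ((pderiv j ψ x : ℝ) : ℂ) * pderiv j a x := by
  have h : gradient ψ x = ∑ j, pderiv j ψ x • EuclideanSpace.single j (1 : ℝ) := by
    ext i
    simp [gradient_apply, Finset.sum_apply, Pi.single_apply]
  conv_lhs => rw [h]
  simp [map_sum, pderiv]

theorem norm_gradient_sq (ψ : Space n → ℝ) (x : Space n) :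
    ‖gradient ψ x‖ ^ 2 = ∑ j, pderiv j ψ x ^ 2 := by
  simp [EuclideanSpace.real_norm_sq_eq, gradient_apply]

/-- Conjugation of `∇ · (g ∇)` with `exp (κ ψ)`. -/
theorem divGrad_exp_mul {g ψ : Space n → ℝ} {a : Space n → ℂ} (hg : ContDiff ℝ ∞ g)
    (hψ : ContDiff ℝ ∞ ψ) (ha : ContDiff ℝ ∞ a) (κ : ℂ) (x : Space n) :
    divGrad g (fun y => Complex.exp (κ * ψ y) * a y) x = Complex.exp (κ * ψ x) *
      (divGrad g a x + κ * (2 * g x * fderiv ℝ a x (gradient ψ x) + (divGrad g ψ x : ℝ) * a x)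
        + κ ^ 2 * (g x * (‖gradient ψ x‖ ^ 2 : ℝ)) * a x) := by
  have hd : ∀ {F : Type} [NormedAddCommGroup F] [NormedSpace ℝ F] {f : Space n → F},
      ContDiff ℝ ∞ f → ∀ y, DifferentiableAt ℝ f y :=
    fun hf y => (hf.differentiable (by simp)) y
  have hψc : ContDiff ℝ ∞ fun y => (ψ y : ℂ) := contDiff_ofReal hψ
  have hgc : ContDiff ℝ ∞ fun y => (g y : ℂ) := contDiff_ofReal hg
  have hE : ContDiff ℝ ∞ fun y => Complex.exp (κ * ψ y) := by fun_prop
  have hj : ∀ j, pderiv j (fun y => g y • pderiv j (fun y => Complex.exp (κ * ψ y) * a y) y) x =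
      Complex.exp (κ * ψ x) * (pderiv j (fun y => g y • pderiv j a y) x
        + κ * (2 * g x * (((pderiv j ψ x : ℝ) : ℂ) * pderiv j a x)
          + (pderiv j (fun y => g y • pderiv j ψ y) x : ℝ) * a x)
        + κ ^ 2 * (g x * (pderiv j ψ x ^ 2 : ℝ)) * a x) := by
    intro j
    have hpψ := contDiff_pderiv_apply hψ j
    have hpa := contDiff_pderiv_apply ha j
    have hgp : ContDiff ℝ ∞ fun y => g y • pderiv j ψ y := hg.smul hpψ
    have hgψ : ContDiff ℝ ∞ fun y => ((g y • pderiv j ψ y : ℝ) : ℂ) :=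
      contDiff_ofReal hgp
    have hga : ContDiff ℝ ∞ fun y => (g y : ℂ) * pderiv j a y := hgc.mul hpa
    -- The flux is grouped so that g ∂_jψ stays one factor; differentiating it whole produces
    -- ∇·(g∇ψ).
    have h1 : (fun y => g y • pderiv j (fun y => Complex.exp (κ * ψ y) * a y) y) = fun y =>
        Complex.exp (κ * ψ y) *
          (κ * (((g y • pderiv j ψ y : ℝ) : ℂ) * a y) + (g y : ℂ) * pderiv j a y) := by
      funext y
      rw [pderiv_mul (hd hE y) (hd ha y), pderiv_exp (hd hψ y), Complex.real_smul, smul_eq_mul]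
      push_cast
      ring
    have h2 : (fun y => g y • pderiv j a y) = fun y => (g y : ℂ) * pderiv j a y := by
      funext y
      rw [Complex.real_smul]
    have h3 := hgψ.mul ha
    have h4 : ContDiff ℝ ∞ fun y => κ * (((g y • pderiv j ψ y : ℝ) : ℂ) * a y) :=
      contDiff_const.mul h3
    rw [h1, h2, pderiv_mul (hd hE x) (hd (h4.add hga) x), pderiv_exp (hd hψ x),
      pderiv_add (hd h4 x) (hd hga x), pderiv_const_mul (hd h3 x), pderiv_mul (hd hgψ x) (hd ha x),
      pderiv_ofReal (hd hgp x), smul_eq_mul]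
    push_cast
    ring
  rw [divGrad, Finset.sum_congr rfl fun j _ => hj j, ← Finset.mul_sum, norm_gradient_sq,
    fderiv_apply_gradient, divGrad, divGrad]
  simp only [Finset.sum_add_distrib, Finset.mul_sum, mul_add, Complex.ofReal_sum, Finset.sum_mul]

theorem divGrad_const_mul {g : Space n → ℝ} {a : Space n → ℂ} (hg : ContDiff ℝ ∞ g)
    (ha : ContDiff ℝ ∞ a) (z : ℂ) (x : Space n) :
    divGrad g (fun y => z * a y) x = z * divGrad g a x := by
  have hd : ∀ {f : Space n → ℂ}, ContDiff ℝ ∞ f → ∀ y, DifferentiableAt ℝ f y :=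
    fun hf y => (hf.differentiable (by simp)) y
  rw [divGrad, divGrad, Finset.mul_sum]
  refine Finset.sum_congr rfl fun j _ => ?_
  have h : ContDiff ℝ ∞ fun y => g y • pderiv j a y := hg.smul (contDiff_pderiv_apply ha j)
  rw [← pderiv_const_mul (hd h x)]
  congr 1
  funext y
  rw [pderiv_const_mul (hd ha y), Complex.real_smul, Complex.real_smul]
  ring

theorem divGrad_add {g : Space n → ℝ} {a b : Space n → ℂ} (hg : ContDiff ℝ ∞ g)
    (ha : ContDiff ℝ ∞ a) (hb : ContDiff ℝ ∞ b) (x : Space n) :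
    divGrad g (fun y => a y + b y) x = divGrad g a x + divGrad g b x := by
  have hd : ∀ {f : Space n → ℂ}, ContDiff ℝ ∞ f → ∀ y, DifferentiableAt ℝ f y :=
    fun hf y => (hf.differentiable (by simp)) y
  rw [divGrad, divGrad, divGrad, ← Finset.sum_add_distrib]
  refine Finset.sum_congr rfl fun j _ => ?_
  have h1 : ContDiff ℝ ∞ fun y => g y • pderiv j a y := hg.smul (contDiff_pderiv_apply ha j)
  have h2 : ContDiff ℝ ∞ fun y => g y • pderiv j b y := hg.smul (contDiff_pderiv_apply hb j)
  rw [← pderiv_add (hd h1 x) (hd h2 x)]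
  congr 1
  funext y
  rw [pderiv_add (hd ha y) (hd hb y), smul_add]

variable {c : Space n → ℝ} {G : Space n → ℝ → ℝ} {ψ : Space n → ℝ} {a b v : Space n → ℝ → ℂ}

theorem SmoothST.fst {F : Type} [NormedAddCommGroup F] [NormedSpace ℝ F] {f : Space n → ℝ → F}
    (hf : SmoothST f) (t : ℝ) : ContDiff ℝ ∞ fun x => f x t :=
  hf.comp contDiff_id contDiff_const

theorem SmoothST.snd {F : Type} [NormedAddCommGroup F] [NormedSpace ℝ F] {f : Space n → ℝ → F}
    (hf : SmoothST f) (x : Space n) : ContDiff ℝ ∞ fun t => f x t :=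
  hf.comp contDiff_const contDiff_id

theorem intervalIntegrable_divGrad (hG : SmoothST G) (ha : SmoothST a) (x : Space n) (t : ℝ) :
    IntervalIntegrable (fun s => divGrad (fun y => G y (t - s)) (fun y => a y s) x) volume 0 t :=
  (contDiff_divGrad_kernel hG ha contDiff_const (contDiff_const.sub contDiff_id)
    contDiff_id).continuous.intervalIntegrable _ _

theorem viscoOp_add (hc : ContDiff ℝ ∞ c) (hG : SmoothST G) (ha : SmoothST a) (hb : SmoothST b)
    (x : Space n) (t : ℝ) :
    viscoOp c G (fun x t => a x t + b x t) x t = viscoOp c G a x t + viscoOp c G b x t := by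
  have h1 : iteratedDeriv 2 (fun τ => a x τ + b x τ) t =
      iteratedDeriv 2 (fun τ => a x τ) t + iteratedDeriv 2 (fun τ => b x τ) t :=
    iteratedDeriv_fun_add (contDiff_infty.1 (ha.snd x) 2).contDiffAt
      (contDiff_infty.1 (hb.snd x) 2).contDiffAt
  simp only [viscoOp, waveOp, memoryOp]
  rw [h1, divGrad_add hc (ha.fst t) (hb.fst t)]
  have h2 : ∀ s, divGrad (fun y => G y (t - s)) (fun y => a y s + b y s) x =
      divGrad (fun y => G y (t - s)) (fun y => a y s) x +
        divGrad (fun y => G y (t - s)) (fun y => b y s) x :=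
    fun s => divGrad_add (hG.fst _) (ha.fst s) (hb.fst s) x
  simp only [h2]
  rw [intervalIntegral.integral_add (intervalIntegrable_divGrad hG ha x t)
    (intervalIntegrable_divGrad hG hb x t)]
  ring

theorem viscoOp_const_mul (hc : ContDiff ℝ ∞ c) (hG : SmoothST G) (ha : SmoothST a) (z : ℂ)
    (x : Space n) (t : ℝ) :
    viscoOp c G (fun x t => z * a x t) x t = z * viscoOp c G a x t := by
  have h1 : iteratedDeriv 2 (fun τ => z * a x τ) t = z * iteratedDeriv 2 (fun τ => a x τ) t :=
    iteratedDeriv_const_mul z (contDiff_infty.1 (ha.snd x) 2).contDiffAt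
  simp only [viscoOp, waveOp, memoryOp]
  rw [h1, divGrad_const_mul hc (ha.fst t)]
  have h2 : ∀ s, divGrad (fun y => G y (t - s)) (fun y => z * a y s) x =
      z * divGrad (fun y => G y (t - s)) (fun y => a y s) x :=
    fun s => divGrad_const_mul (hG.fst _) (ha.fst s) z x
  simp only [h2]
  rw [intervalIntegral.integral_const_mul]
  ring

/-- Conjugation of the viscoacoustic operator with `exp (κ ψ)`, for a solution `ψ` of the eikonal
equation. -/
theorem viscoOp_exp_mul (hc : ContDiff ℝ ∞ c) (hG : SmoothST G) (hψ : ContDiff ℝ ∞ ψ)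
    (hv : SmoothST v) (κ : ℂ) {x : Space n} (hcx : 0 < c x)
    (heik : ‖gradient ψ x‖ ^ 2 = (c x)⁻¹) (t : ℝ) :
    viscoOp c G (fun x t => Complex.exp (κ * ψ x) * v x t) x t = Complex.exp (κ * ψ x) *
      (viscoOp c G v x t + κ * firstOrderOp c G ψ v x t + κ ^ 2 / 2 * volterraOp c G v x t) := by
  have hcc : (c x : ℂ) * ((c x)⁻¹ : ℝ) = 1 := by
    rw [← Complex.ofReal_mul, mul_inv_cancel₀ hcx.ne', Complex.ofReal_one]
  have h1 : iteratedDeriv 2 (fun τ => Complex.exp (κ * ψ x) * v x τ) t =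
      Complex.exp (κ * ψ x) * iteratedDeriv 2 (fun τ => v x τ) t :=
    iteratedDeriv_const_mul _ (contDiff_infty.1 (hv.snd x) 2).contDiffAt
  have h2 : ∀ s, divGrad (fun y => G y (t - s)) (fun y => Complex.exp (κ * ψ y) * v y s) x =
      Complex.exp (κ * ψ x) * (divGrad (fun y => G y (t - s)) (fun y => v y s) x +
        κ * (-2) * memB G ψ v x t s
        + κ ^ 2 * ((((c x)⁻¹ * G x (t - s) : ℝ) : ℂ) * v x s)) := by
    intro s
    rw [divGrad_exp_mul (hG.fst _) hψ (hv.fst s), memB, gradDot, heik]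
    push_cast
    ring
  have hB : IntervalIntegrable (fun s => memB G ψ v x t s) volume 0 t :=
    (contDiff_memB hG hψ hv contDiff_const contDiff_const
      contDiff_id).continuous.intervalIntegrable _ _
  have hA : IntervalIntegrable (fun s => (((c x)⁻¹ * G x (t - s) : ℝ) : ℂ) * v x s) volume 0 t := by
    refine (ContDiff.continuous (𝕜 := ℝ) (n := ∞) ?_).intervalIntegrable _ _
    exact (contDiff_ofReal (contDiff_const.mul (hG.comp contDiff_const
      (contDiff_const.sub contDiff_id)))).mul (hv.snd x)
  simp only [viscoOp, waveOp, memoryOp, firstOrderOp, volterraOp]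
  rw [h1, divGrad_exp_mul hc hψ (hv.fst t), heik]
  simp only [h2]
  rw [intervalIntegral.integral_const_mul, intervalIntegral.integral_add
    ((intervalIntegrable_divGrad hG hv x t).add (hB.const_mul _)) (hA.const_mul _),
    intervalIntegral.integral_add (intervalIntegrable_divGrad hG hv x t) (hB.const_mul _),
    intervalIntegral.integral_const_mul, intervalIntegral.integral_const_mul]
  simp only [gradDot]
  -- The eikonal equation enters as c·c⁻¹ = 1 in the κ² term.
  linear_combination (1 / 2 * Complex.exp (κ * ψ x) * κ ^ 2 * v x t) * hcc

end Conjugation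

/-! ### Time oscillation and integration by parts in the memory integral -/

section Oscillation

variable {n : ℕ} {c : Space n → ℝ} {G : Space n → ℝ → ℝ} {ψ : Space n → ℝ} {a : Space n → ℝ → ℂ}

/-- `∫_0^t exp (-κ s) f(s) ds`. -/
def laplaceIntegral (κ : ℂ) (f : ℝ → ℂ) (t : ℝ) : ℂ :=
  ∫ s in (0 : ℝ)..t, Complex.exp (-(κ * s)) * f s

theorem hasDerivAt_exp_neg_mul (κ : ℂ) (t : ℝ) :
    HasDerivAt (fun s : ℝ => Complex.exp (-(κ * s))) (Complex.exp (-(κ * t)) * (-κ)) t := by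
  have h : HasDerivAt (fun s : ℝ => -(κ * (s : ℂ))) (-κ) t := by
    simpa using ((Complex.ofRealCLM.hasDerivAt (x := t)).const_mul κ).fun_neg
  exact h.cexp

theorem contDiff_exp_neg_mul (κ : ℂ) : ContDiff ℝ ∞ fun s : ℝ => Complex.exp (-(κ * s)) := by
  have : ContDiff ℝ ∞ fun s : ℝ => (s : ℂ) := contDiff_ofReal contDiff_id
  fun_prop

/-- One integration by parts. Of the two boundary terms, the one at s = t keeps the factor exp(-κt)
and the one at s = 0 loses it; this split generates the two hierarchies. -/
theorem mul_laplaceIntegral (κ : ℂ) {f : ℝ → ℂ} (hf : ContDiff ℝ ∞ f) (t : ℝ) :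
    κ * laplaceIntegral κ f t =
      -(Complex.exp (-(κ * t)) * f t) + f 0 + laplaceIntegral κ (deriv f) t := by
  have hE := (contDiff_exp_neg_mul κ).continuous
  have hf' : Continuous (deriv f) := hf.continuous_deriv (by simp)
  have h := intervalIntegral.integral_mul_deriv_eq_deriv_mul (a := 0) (b := t)
    (u := fun s : ℝ => Complex.exp (-(κ * s))) (v := f)
    (fun s _ => hasDerivAt_exp_neg_mul κ s)
    (fun s _ => ((hf.differentiable (by simp)) s).hasDerivAt)
    (Continuous.intervalIntegrable (by fun_prop) _ _) (hf'.intervalIntegrable _ _)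
  have h2 : ∫ s in (0 : ℝ)..t, Complex.exp (-(κ * s)) * (-κ) * f s =
      -κ * laplaceIntegral κ f t := by
    rw [laplaceIntegral, ← intervalIntegral.integral_const_mul]
    congr 1
    funext s
    ring
  rw [h2] at h
  rw [laplaceIntegral.eq_1 κ (deriv f), h]
  simp
  ring

theorem laplaceIntegral_add (κ : ℂ) {f g : ℝ → ℂ} (hf : Continuous f) (hg : Continuous g) (t : ℝ) :
    laplaceIntegral κ (fun s => f s + g s) t = laplaceIntegral κ f t + laplaceIntegral κ g t := by
  have hE := (contDiff_exp_neg_mul κ).continuous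
  rw [laplaceIntegral, laplaceIntegral, laplaceIntegral, ← intervalIntegral.integral_add
    (Continuous.intervalIntegrable (by fun_prop) _ _)
    (Continuous.intervalIntegrable (by fun_prop) _ _)]
  simp only [mul_add]

theorem iteratedDeriv_two_exp_mul (κ : ℂ) {f : ℝ → ℂ} (hf : ContDiff ℝ ∞ f) (t : ℝ) :
    iteratedDeriv 2 (fun s : ℝ => Complex.exp (-(κ * s)) * f s) t = Complex.exp (-(κ * t)) *
      (iteratedDeriv 2 f t - 2 * κ * deriv f t + κ ^ 2 * f t) := by
  have hf1 : ∀ s, HasDerivAt f (deriv f s) s := fun s =>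
    ((hf.differentiable (by simp)) s).hasDerivAt
  have hf2 : ∀ s, HasDerivAt (deriv f) (deriv (deriv f) s) s := fun s =>
    (((contDiff_infty_iff_deriv.1 hf).2.differentiable (by simp)) s).hasDerivAt
  have h1 : deriv (fun s : ℝ => Complex.exp (-(κ * s)) * f s) =
      fun s : ℝ => Complex.exp (-(κ * s)) * (deriv f s - κ * f s) := by
    funext s
    rw [((hasDerivAt_exp_neg_mul κ s).fun_mul (hf1 s)).deriv]
    ring
  rw [iteratedDeriv_succ, iteratedDeriv_one, h1,
    ((hasDerivAt_exp_neg_mul κ t).fun_mul ((hf2 t).fun_sub ((hf1 t).const_mul κ))).deriv,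
    iteratedDeriv_succ, iteratedDeriv_one]
  ring

theorem gradDot_time_mul (ha : SmoothST a) (z : ℝ → ℂ) (x : Space n) (t : ℝ) :
    gradDot ψ (fun x t => z t * a x t) x t = z t * gradDot ψ a x t := by
  rw [gradDot, gradDot, fderiv_const_mul (((ha.fst t).differentiable (by simp)) x)]
  simp

/-- The term c⁻¹G(x,0)a in the transport operator is the boundary term at s = t of the 𝒜 integral,
up to a factor. Separating it lets it cancel after integration by parts. -/
theorem transportOp_eq (x : Space n) (t : ℝ) :
    transportOp c G ψ a x t = 2 * (deriv (fun τ => a x τ) t + c x * gradDot ψ a x t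
      + 1 / 2 * (divGrad c ψ x : ℝ) * a x t - memA c G a x t t) := by
  simp only [transportOp, transportCoeff, memA, sub_self]
  push_cast
  ring

/-- Action of the viscoacoustic operator on a wave `exp (-κ (t - ψ)) a`. -/
theorem viscoOp_wave (hc : ContDiff ℝ ∞ c) (hc0 : ∀ x, 0 < c x) (hG : SmoothST G)
    (hψ : ContDiff ℝ ∞ ψ) (ha : SmoothST a) (κ : ℂ) {x : Space n}
    (heik : ‖gradient ψ x‖ ^ 2 = (c x)⁻¹) (t : ℝ) :
    viscoOp c G (fun x t => Complex.exp (κ * ψ x) * (Complex.exp (-(κ * t)) * a x t)) x t =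
      Complex.exp (κ * ψ x) *
        (Complex.exp (-(κ * t)) * (waveOp c a x t
            + κ * (1 / 2 * transportOp c G ψ a x t + memA c G a x t t))
          + laplaceIntegral κ (memC G a x t) t + κ * laplaceIntegral κ (memB G ψ a x t) t
          + κ ^ 2 * laplaceIntegral κ (memA c G a x t) t) := by
  have hv : SmoothST fun x t => Complex.exp (-(κ * t)) * a x t :=
    ((contDiff_exp_neg_mul κ).comp contDiff_snd).mul ha
  -- The -κ²/2 from ∂_t² will cancel the identity part of (κ²/2)V, so only the 𝒜 integral survives
  -- at order κ².
  rw [viscoOp_exp_mul hc hG hψ hv κ (hc0 x) heik]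
  simp only [viscoOp, waveOp, memoryOp, firstOrderOp, volterraOp, laplaceIntegral]
  rw [iteratedDeriv_two_exp_mul κ (ha.snd x), divGrad_const_mul hc (ha.fst t)]
  have hC : ∀ s : ℝ, divGrad (fun y => G y (t - s)) (fun y => Complex.exp (-(κ * s)) * a y s) x =
      -2 * (Complex.exp (-(κ * s)) * memC G a x t s) := by
    intro s
    rw [divGrad_const_mul (hG.fst _) (ha.fst s), memC]
    ring
  have hB : ∀ s : ℝ, memB G ψ (fun x t => Complex.exp (-(κ * t)) * a x t) x t s =
      Complex.exp (-(κ * s)) * memB G ψ a x t s := by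
    intro s
    rw [memB, memB, gradDot_time_mul ha (fun t : ℝ => Complex.exp (-(κ * t)))]
    ring
  have hA : ∀ s : ℝ, (((c x)⁻¹ * G x (t - s) : ℝ) : ℂ) * (Complex.exp (-(κ * s)) * a x s) =
      -2 * (Complex.exp (-(κ * s)) * memA c G a x t s) := by
    intro s
    rw [memA]
    ring
  simp only [hC, hB, hA]
  rw [intervalIntegral.integral_const_mul, intervalIntegral.integral_const_mul,
    gradDot_time_mul ha (fun t : ℝ => Complex.exp (-(κ * t))), transportOp_eq]
  ring

end Oscillation

/-! ### Exact residual of the truncated ansatz -/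

section Expansion

variable {n : ℕ} {c : Space n → ℝ} {G : Space n → ℝ → ℝ} {ψ : Space n → ℝ}
  {a' a'' : ℕ → Space n → ℝ → ℂ}

/-- The memory terms of order `L` which remain under the integral sign. -/
def memTail (c : Space n → ℝ) (G : Space n → ℝ → ℝ) (ψ : Space n → ℝ)
    (a : ℕ → Space n → ℝ → ℂ) (L : ℕ) (x : Space n) (t s : ℝ) : ℂ :=
  ∑ m ∈ Finset.range (L + 1), (iteratedDeriv (L + 1 - m) (fun s => memA c G (a m) x t s) s
      + iteratedDeriv (L - m) (fun s => memB G ψ (a m) x t s) s)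
    + ∑ m ∈ Finset.range L, iteratedDeriv (L - 1 - m) (fun s => memC G (a m) x t s) s

/-- The contribution of `a''_{l-1}` to the order which follows the `l`-th one. -/
def laggedVisco (c : Space n → ℝ) (G : Space n → ℝ → ℝ)
    (a'' : ℕ → Space n → ℝ → ℂ) : ℕ → Space n → ℝ → ℂ
  | 0, _, _ => 0
  | l + 1, x, t => viscoOp c G (a'' l) x t

theorem volterraLower_succ (l : ℕ) (x : Space n) (t : ℝ) :
    volterraLower c G ψ a'' (l + 1) x t =
      firstOrderOp c G ψ (a'' l) x t + laggedVisco c G a'' l x t := by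
  cases l <;> simp [volterraLower, laggedVisco]

/-- The memory part of this source is the tail at s = t; the value of the same tail at s = 0 feeds
the Volterra source of the same index. -/
theorem transportSource_succ (l : ℕ) (x : Space n) (t : ℝ) :
    transportSource c G ψ a' (l + 1) x t =
      -2 * (waveOp c (a' l) x t - memTail c G ψ a' l x t t) := by
  rw [transportSource, memTail]
  ring

theorem volterraSource_zero (x : Space n) (t : ℝ) :
    volterraSource c G ψ a' a'' 0 x t = -2 * memA c G (a' 0) x t 0 := by
  simp [volterraSource, volterraLower]

theorem volterraSource_succ (l : ℕ) (x : Space n) (t : ℝ) :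
    volterraSource c G ψ a' a'' (l + 1) x t =
      -2 * (firstOrderOp c G ψ (a'' l) x t + laggedVisco c G a'' l x t
        + memTail c G ψ a' l x t 0 + memA c G (a' (l + 1)) x t 0) := by
  rw [volterraSource, volterraLower_succ, Finset.sum_range_succ _ (l + 1), memTail,
    Finset.sum_add_distrib]
  simp only [Nat.sub_self, iteratedDeriv_zero, Nat.add_sub_cancel,
    show l + 1 - 2 = l - 1 by lia]
  ring

theorem contDiff_memTail (hc : ContDiff ℝ ∞ c) (hc0 : ∀ x, 0 < c x) (hG : SmoothST G)
    (hψ : ContDiff ℝ ∞ ψ) 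
    (ha : ∀ l, SmoothST (a' l)) (L : ℕ)
    {P : Type} [NormedAddCommGroup P] [NormedSpace ℝ P] {x : P → Space n} {t s : P → ℝ}
    (hx : ContDiff ℝ ∞ x) (ht : ContDiff ℝ ∞ t) (hs : ContDiff ℝ ∞ s) :
    ContDiff ℝ ∞ (fun p => memTail c G ψ a' L (x p) (t p) (s p)) := by
  refine (ContDiff.sum fun m _ => ContDiff.add ?_ ?_).add (ContDiff.sum fun m _ => ?_)
  · exact contDiff_iteratedDeriv_memA hc hc0 hG (ha m) _ hx ht hs
  · exact contDiff_iteratedDeriv_memB hG hψ (ha m) _ hx ht hs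
  · exact contDiff_iteratedDeriv_memC hG (ha m) _ hx ht hs

theorem memTail_zero (x : Space n) (t s : ℝ) :
    memTail c G ψ a' 0 x t s =
      deriv (fun s => memA c G (a' 0) x t s) s + memB G ψ (a' 0) x t s := by
  simp [memTail]

/-- Integrating the tail by parts differentiates it once in s. At the new order 𝒞 of the previous
amplitude joins it, together with ∂_s𝒜 and ℬ of the new one. -/
theorem memTail_succ (hc : ContDiff ℝ ∞ c) (hc0 : ∀ x, 0 < c x) (hG : SmoothST G)
    (hψ : ContDiff ℝ ∞ ψ) 
    (ha : ∀ l, SmoothST (a' l)) (L : ℕ) (x : Space n) (t s : ℝ) :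
    memTail c G ψ a' (L + 1) x t s =
      deriv (fun s => memTail c G ψ a' L x t s) s + memC G (a' L) x t s
        + deriv (fun s => memA c G (a' (L + 1)) x t s) s + memB G ψ (a' (L + 1)) x t s := by
  have hA : ∀ m k, DifferentiableAt ℝ (iteratedDeriv k (fun s => memA c G (a' m) x t s)) s :=
    fun m k => ((contDiff_iteratedDeriv_memA hc hc0 hG (ha m) k contDiff_const contDiff_const
      contDiff_id).differentiable (by simp)) s
  have hB : ∀ m k, DifferentiableAt ℝ (iteratedDeriv k (fun s => memB G ψ (a' m) x t s)) s :=
    fun m k => ((contDiff_iteratedDeriv_memB hG hψ (ha m) k contDiff_const contDiff_const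
      contDiff_id).differentiable (by simp)) s
  have hC : ∀ m k, DifferentiableAt ℝ (iteratedDeriv k (fun s => memC G (a' m) x t s)) s :=
    fun m k => ((contDiff_iteratedDeriv_memC hG (ha m) k contDiff_const contDiff_const
      contDiff_id).differentiable (by simp)) s
  have hd : deriv (fun s => memTail c G ψ a' L x t s) s =
      ∑ m ∈ Finset.range (L + 1), (iteratedDeriv (L + 1 + 1 - m) (fun s => memA c G (a' m) x t s) s
        + iteratedDeriv (L + 1 - m) (fun s => memB G ψ (a' m) x t s) s)
      + ∑ m ∈ Finset.range L, iteratedDeriv (L - m) (fun s => memC G (a' m) x t s) s := by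
    simp only [memTail]
    rw [deriv_fun_add (DifferentiableAt.fun_sum fun m _ => (hA m _).fun_add (hB m _))
      (DifferentiableAt.fun_sum fun m _ => hC m _),
      deriv_fun_sum fun m _ => (hA m _).fun_add (hB m _), deriv_fun_sum fun m _ => hC m _]
    congr 1
    · refine Finset.sum_congr rfl fun m hm => ?_
      have hm' : m ≤ L := Nat.lt_succ_iff.1 (Finset.mem_range.1 hm)
      rw [deriv_fun_add (hA m _) (hB m _), ← iteratedDeriv_succ, ← iteratedDeriv_succ]
      congr 2 <;> lia
    · refine Finset.sum_congr rfl fun m hm => ?_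
      have hm' : m < L := Finset.mem_range.1 hm
      rw [← iteratedDeriv_succ]
      congr 1
      lia
  rw [hd, memTail, Finset.sum_range_succ _ (L + 1), Nat.add_sub_cancel,
    Finset.sum_range_succ (fun m => iteratedDeriv (L - m) _ s) L]
  simp only [Nat.sub_self, iteratedDeriv_zero, Nat.add_sub_cancel_left, iteratedDeriv_one]
  ring

theorem ansatz_zero (k : ℝ) : ansatz ψ a' a'' 0 k = fun x (t : ℝ) =>
    Complex.exp (-(Complex.I * k) * ψ x) *
      (Complex.exp (-(-(Complex.I * k) * t)) * a' 0 x t) := by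
  funext x t
  simp only [ansatz]
  rw [← mul_assoc (Complex.exp _), ← Complex.exp_add]
  simp
  ring_nf
  simp

/-- The factor exp(-ikt) in front of a'' cancels the time phase, so that correction carries only
exp(κψ). -/
theorem ansatz_succ (L : ℕ) (k : ℝ) : ansatz ψ a' a'' (L + 1) k = fun x (t : ℝ) =>
    ansatz ψ a' a'' L k x t + (((-(Complex.I * k)) ^ (L + 1))⁻¹ *
        (Complex.exp (-(Complex.I * k) * ψ x) *
          (Complex.exp (-(-(Complex.I * k) * t)) * a' (L + 1) x t))
      + ((-(Complex.I * k)) ^ (L + 1))⁻¹ *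
        (Complex.exp (-(Complex.I * k) * ψ x) * a'' L x t)) := by
  funext x t
  have h1 : Complex.exp (Complex.I * k * (t - ψ x)) = Complex.exp (-(Complex.I * k) * ψ x) *
      Complex.exp (-(-(Complex.I * k) * t)) := by
    rw [← Complex.exp_add]
    ring_nf
  have h2 : Complex.exp (-(-(Complex.I * k) * t)) * Complex.exp (-(Complex.I * k * t)) = 1 := by
    rw [← Complex.exp_add]
    simp
  simp only [ansatz]
  rw [Finset.sum_Icc_succ_top (by lia), h1, Nat.add_sub_cancel]
  linear_combination (((-(Complex.I * k)) ^ (L + 1))⁻¹ *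
    Complex.exp (-(Complex.I * k) * ψ x) * a'' L x t) * h2

theorem contDiff_exp_mul_phase (hψ : ContDiff ℝ ∞ ψ) (κ : ℂ) : ContDiff ℝ ∞ fun x => Complex.exp (κ * ψ x) := by
  have := contDiff_ofReal hψ
  fun_prop

theorem smoothST_wave (hψ : ContDiff ℝ ∞ ψ) {a : Space n → ℝ → ℂ} (ha : SmoothST a) (κ : ℂ) :
    SmoothST fun x t => Complex.exp (κ * ψ x) * (Complex.exp (-(κ * t)) * a x t) :=
  ((contDiff_exp_mul_phase hψ κ).comp contDiff_fst).mul
    (((contDiff_exp_neg_mul κ).comp contDiff_snd).mul ha)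

theorem smoothST_exp_mul (hψ : ContDiff ℝ ∞ ψ) {a : Space n → ℝ → ℂ} (ha : SmoothST a) (κ : ℂ) :
    SmoothST fun x t => Complex.exp (κ * ψ x) * a x t :=
  ((contDiff_exp_mul_phase hψ κ).comp contDiff_fst).mul ha

theorem smoothST_ansatz (hψ : ContDiff ℝ ∞ ψ) (ha' : ∀ l, SmoothST (a' l)) (ha'' : ∀ l, SmoothST (a'' l)) (L : ℕ)
    (k : ℝ) : SmoothST (ansatz ψ a' a'' L k) := by
  induction L with
  | zero =>
    rw [ansatz_zero]
    exact smoothST_wave hψ (ha' 0) _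
  | succ L ih =>
    rw [ansatz_succ]
    exact ContDiff.add ih ((contDiff_const.mul (smoothST_wave hψ (ha' _) _)).add
      (contDiff_const.mul (smoothST_exp_mul hψ (ha'' _) _)))

/-- The residual of the geometrical optics ansatz. -/
theorem viscoOp_ansatz (hc : ContDiff ℝ ∞ c) (hc0 : ∀ x, 0 < c x) (hG : SmoothST G)
    (hψ : ContDiff ℝ ∞ ψ) 
    (ha' : ∀ l, SmoothST (a' l)) (ha'' : ∀ l, SmoothST (a'' l))
    {k : ℝ} (hk : 0 < k) {x : Space n} (heik : ‖gradient ψ x‖ ^ 2 = (c x)⁻¹) {t : ℝ}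
    (htr : ∀ l, transportOp c G ψ (a' l) x t = transportSource c G ψ a' l x t)
    (hvo : ∀ l, volterraOp c G (a'' l) x t = volterraSource c G ψ a' a'' l x t)
    {κ : ℂ} (hκ : κ = -(Complex.I * k)) (L : ℕ) :
    viscoOp c G (ansatz ψ a' a'' L k) x t = Complex.exp (κ * ψ x) * (κ ^ L)⁻¹ *
      (Complex.exp (-(κ * t)) * waveOp c (a' L) x t
        + κ * laplaceIntegral κ (memTail c G ψ a' L x t) t
        + laplaceIntegral κ (memC G (a' L) x t) t
        - κ / 2 * volterraSource c G ψ a' a'' L x t + laggedVisco c G a'' L x t) := by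
  have hκ0 : κ ≠ 0 := by
    rw [hκ]
    simp [hk.ne']
  have hA : ∀ m, ContDiff ℝ ∞ (memA c G (a' m) x t) := fun m =>
    contDiff_memA hc hc0 hG (ha' m) contDiff_const contDiff_const contDiff_id
  have hB : ∀ m, ContDiff ℝ ∞ (memB G ψ (a' m) x t) := fun m =>
    contDiff_memB hG hψ (ha' m) contDiff_const contDiff_const contDiff_id
  have hC : ∀ m, ContDiff ℝ ∞ (memC G (a' m) x t) := fun m =>
    contDiff_memC hG (ha' m) contDiff_const contDiff_const contDiff_id
  have hH : ∀ m, ContDiff ℝ ∞ (memTail c G ψ a' m x t) := fun m =>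
    contDiff_memTail hc hc0 hG hψ ha' m contDiff_const contDiff_const contDiff_id
  have hdA : ∀ m, Continuous (deriv (memA c G (a' m) x t)) := fun m =>
    (hA m).continuous_deriv (by simp)
  have hdH : ∀ m, Continuous (deriv (memTail c G ψ a' m x t)) := fun m =>
    (hH m).continuous_deriv (by simp)
  have hIA := fun m => mul_laplaceIntegral κ (hA m) t
  induction L with
  | zero =>
    have htail : laplaceIntegral κ (memTail c G ψ a' 0 x t) t =
        laplaceIntegral κ (deriv (memA c G (a' 0) x t)) t
          + laplaceIntegral κ (memB G ψ (a' 0) x t) t := by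
      rw [← laplaceIntegral_add κ (hdA 0) (hB 0).continuous]
      congr 1
      funext s
      exact memTail_zero x t s
    have h0 : transportOp c G ψ (a' 0) x t = 0 := htr 0
    rw [ansatz_zero, ← hκ, viscoOp_wave hc hc0 hG hψ (ha' 0) κ heik, htail, h0,
      volterraSource_zero]
    simp only [laggedVisco, pow_zero, inv_one]
    -- The boundary term at s = t cancels the 𝒜 term of the wave formula; the one at s = 0 is the
    -- initial Volterra source.
    linear_combination Complex.exp (κ * ψ x) * κ * hIA 0
  | succ L ih =>
    have htail : laplaceIntegral κ (memTail c G ψ a' (L + 1) x t) t =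
        laplaceIntegral κ (deriv (memTail c G ψ a' L x t)) t
          + laplaceIntegral κ (memC G (a' L) x t) t
          + laplaceIntegral κ (deriv (memA c G (a' (L + 1)) x t)) t
          + laplaceIntegral κ (memB G ψ (a' (L + 1)) x t) t := by
      have h1 : Continuous fun s => deriv (memTail c G ψ a' L x t) s + memC G (a' L) x t s :=
        (hdH L).add (hC L).continuous
      have h2 : Continuous fun s => deriv (memTail c G ψ a' L x t) s + memC G (a' L) x t s
          + deriv (memA c G (a' (L + 1)) x t) s := h1.add (hdA (L + 1))
      rw [← laplaceIntegral_add κ (hdH L) (hC L).continuous,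
        ← laplaceIntegral_add κ h1 (hdA (L + 1)),
        ← laplaceIntegral_add κ h2 (hB (L + 1)).continuous]
      congr 1
      funext s
      exact memTail_succ hc hc0 hG hψ ha' L x t s
    have hwave := smoothST_wave hψ (ha' (L + 1)) κ
    have hexp := smoothST_exp_mul hψ (ha'' L) κ
    have hwave' : SmoothST fun x t => (κ ^ (L + 1))⁻¹ *
        (Complex.exp (κ * ψ x) * (Complex.exp (-(κ * t)) * a' (L + 1) x t)) :=
      contDiff_const.mul hwave
    have hexp' : SmoothST fun x t => (κ ^ (L + 1))⁻¹ * (Complex.exp (κ * ψ x) * a'' L x t) :=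
      contDiff_const.mul hexp
    have hsum : SmoothST fun x t => (κ ^ (L + 1))⁻¹ *
          (Complex.exp (κ * ψ x) * (Complex.exp (-(κ * t)) * a' (L + 1) x t)) +
        (κ ^ (L + 1))⁻¹ * (Complex.exp (κ * ψ x) * a'' L x t) := ContDiff.add hwave' hexp'
    have hIH := mul_laplaceIntegral κ (hH L) t
    have htr' := htr (L + 1)
    rw [transportSource_succ] at htr'
    have hvo' := hvo L
    rw [ansatz_succ, ← hκ, viscoOp_add hc hG (smoothST_ansatz hψ ha' ha'' L k)
      hsum, viscoOp_add hc hG hwave' hexp',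
      viscoOp_const_mul hc hG hwave, viscoOp_const_mul hc hG hexp,
      viscoOp_wave hc hc0 hG hψ (ha' (L + 1)) κ heik,
      viscoOp_exp_mul hc hG hψ (ha'' L) κ (hc0 x) heik, ih, htail, htr', hvo',
      volterraSource_succ L]
    -- Brings the inductive residual to the normalisation of the new corrections.
    have hq : (κ ^ L)⁻¹ = (κ ^ (L + 1))⁻¹ * κ := by
      rw [pow_succ]
      field_simp
    rw [hq]
    simp only [laggedVisco]
    -- Two integrations by parts close the step: `hIH` for the inherited tail and `hIA` for 𝒜 of the
    -- new amplitude. The terms at s = t cancel through the transport equation, those at s = 0 enter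
    -- the next Volterra source.
    linear_combination Complex.exp (κ * ψ x) * (κ ^ (L + 1))⁻¹ * κ * (hIA (L + 1) + hIH)

end Expansion

/-! ### Uniform and L² bounds on the residual -/

section Estimate

variable {n : ℕ} {c : Space n → ℝ} {G : Space n → ℝ → ℝ} {ψ : Space n → ℝ}
  {a' a'' : ℕ → Space n → ℝ → ℂ} {Ω : Set (Space n)} {T : ℝ}

theorem exists_norm_le_of_isBounded {X : Type} [PseudoMetricSpace X] [ProperSpace X] {f : X → ℂ}
    (hf : Continuous f) {S : Set X} (hS : Bornology.IsBounded S) :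
    ∃ M : ℝ, 0 ≤ M ∧ ∀ x ∈ S, ‖f x‖ ≤ M := by
  obtain ⟨M, hM⟩ := hS.isCompact_closure.exists_bound_of_continuousOn hf.continuousOn
  exact ⟨max M 0, le_max_right _ _, fun x hx => (hM x (subset_closure hx)).trans (le_max_left _ _)⟩

theorem SmoothST.exists_norm_le {f : Space n → ℝ → ℂ} (hf : SmoothST f)
    (hΩ : Bornology.IsBounded Ω) (T : ℝ) :
    ∃ M : ℝ, 0 ≤ M ∧ ∀ x ∈ Ω, ∀ t ∈ Icc 0 T, ‖f x t‖ ≤ M := by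
  obtain ⟨M, hM, h⟩ := exists_norm_le_of_isBounded (ContDiff.continuous hf)
    (hΩ.prod (Metric.isBounded_Icc 0 T))
  exact ⟨M, hM, fun x hx t ht => h (x, t) ⟨hx, ht⟩⟩

theorem exists_norm_kernel_le {f : Space n → ℝ → ℝ → ℂ}
    (hf : ContDiff ℝ ∞ fun q : Space n × ℝ × ℝ => f q.1 q.2.1 q.2.2)
    (hΩ : Bornology.IsBounded Ω) (T : ℝ) :
    ∃ M : ℝ, 0 ≤ M ∧ ∀ x ∈ Ω, ∀ t ∈ Icc 0 T, ∀ s ∈ Icc 0 T, ‖f x t s‖ ≤ M := by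
  obtain ⟨M, hM, h⟩ := exists_norm_le_of_isBounded hf.continuous
    (hΩ.prod ((Metric.isBounded_Icc 0 T).prod (Metric.isBounded_Icc 0 T)))
  exact ⟨M, hM, fun x hx t ht s hs => h (x, t, s) ⟨hx, ht, hs⟩⟩

theorem norm_laplaceIntegral_le {κ : ℂ} (hκ : κ.re = 0) {f : ℝ → ℂ} {t M : ℝ} (hM : 0 ≤ M)
    (ht : t ∈ Icc 0 T) (hf : ∀ s ∈ Icc 0 T, ‖f s‖ ≤ M) : ‖laplaceIntegral κ f t‖ ≤ M * T := by
  have h : ∀ s ∈ uIoc 0 t, ‖Complex.exp (-(κ * s)) * f s‖ ≤ M := by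
    intro s hs
    rw [uIoc_of_le ht.1] at hs
    rw [norm_mul, Complex.norm_exp]
    simpa [hκ] using hf s ⟨hs.1.le, hs.2.trans ht.2⟩
  refine (intervalIntegral.norm_integral_le_of_norm_le_const h).trans ?_
  rw [sub_zero, abs_of_nonneg ht.1]
  exact mul_le_mul_of_nonneg_left ht.2 hM

theorem exists_norm_viscoOp_ansatz_le (hc : ContDiff ℝ ∞ c) (hc0 : ∀ x, 0 < c x) (hG : SmoothST G)
    (hψ : ContDiff ℝ ∞ ψ) (hΩ : Bornology.IsBounded Ω)
    (heik : ∀ x ∈ Ω, ‖gradient ψ x‖ ^ 2 = (c x)⁻¹)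
    (ha' : ∀ l, SmoothST (a' l)) (ha'' : ∀ l, SmoothST (a'' l))
    (htr : ∀ l, ∀ x ∈ Ω, ∀ t ∈ Icc 0 T,
      transportOp c G ψ (a' l) x t = transportSource c G ψ a' l x t)
    (hvo : ∀ l, ∀ x ∈ Ω, ∀ t ∈ Icc 0 T,
      volterraOp c G (a'' l) x t = volterraSource c G ψ a' a'' l x t) (N : ℕ) :
    ∃ M : ℝ, ∀ k : ℝ, 1 ≤ k → ∀ x ∈ Ω, ∀ t ∈ Icc 0 T,
      ‖viscoOp c G (ansatz ψ a' a'' (N + 1) k) x t‖ ≤ M * (k ^ N)⁻¹ := by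
  obtain ⟨W, hW, hWb⟩ := (smoothST_waveOp hc (ha' (N + 1))).exists_norm_le hΩ T
  obtain ⟨H, hH, hHb⟩ := exists_norm_kernel_le (f := memTail c G ψ a' (N + 1))
    (contDiff_memTail hc hc0 hG hψ ha' (N + 1) (by fun_prop) (by fun_prop) (by fun_prop)) hΩ T
  obtain ⟨C, hC, hCb⟩ := exists_norm_kernel_le (f := memC G (a' (N + 1)))
    (contDiff_memC hG (ha' (N + 1)) (by fun_prop) (by fun_prop) (by fun_prop)) hΩ T
  obtain ⟨S, hS, hSb⟩ := (smoothST_volterraSource hc hc0 hG hψ (N + 1) ha'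
    (fun m _ => ha'' m)).exists_norm_le hΩ T
  obtain ⟨V, hV, hVb⟩ := (smoothST_viscoOp hc hG (ha'' N)).exists_norm_le hΩ T
  -- Since κ is purely imaginary the exponentials have modulus one, so for k ≥ 1 each of the five
  -- residual terms is at most k times a constant, against the prefactor k^(-(N+1)).
  refine ⟨W + H * T + C * T + S + V, fun k hk x hx t ht => ?_⟩
  have hk0 : 0 < k := one_pos.trans_le hk
  have hT : 0 ≤ T := ht.1.trans ht.2
  set κ : ℂ := -(Complex.I * k) with hκ
  have hre : κ.re = 0 := by simp [hκ]
  have hnorm : ‖κ‖ = k := by simp [hκ, abs_of_pos hk0]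
  rw [viscoOp_ansatz hc hc0 hG hψ ha' ha'' hk0 (heik x hx) (fun l => htr l x hx t ht)
    (fun l => hvo l x hx t ht) hκ (N + 1)]
  have hE : ∀ r : ℝ, ‖Complex.exp (κ * r)‖ = 1 := fun r => by
    rw [Complex.norm_exp]
    simp [hre]
  have hE' : ‖Complex.exp (-(κ * t))‖ = 1 := by
    rw [Complex.norm_exp]
    simp [hre]
  have h1 : ‖Complex.exp (-(κ * t)) * waveOp c (a' (N + 1)) x t‖ ≤ k * W := by
    rw [norm_mul, hE', one_mul]
    exact (hWb x hx t ht).trans (le_mul_of_one_le_left hW hk)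
  have h2 : ‖κ * laplaceIntegral κ (memTail c G ψ a' (N + 1) x t) t‖ ≤ k * (H * T) := by
    rw [norm_mul, hnorm]
    exact mul_le_mul_of_nonneg_left (norm_laplaceIntegral_le hre hH ht (hHb x hx t ht)) hk0.le
  have h3 : ‖laplaceIntegral κ (memC G (a' (N + 1)) x t) t‖ ≤ k * (C * T) :=
    (norm_laplaceIntegral_le hre hC ht (hCb x hx t ht)).trans
      (le_mul_of_one_le_left (by positivity) hk)
  have h4 : ‖κ / 2 * volterraSource c G ψ a' a'' (N + 1) x t‖ ≤ k * S := by
    rw [norm_mul, norm_div, hnorm]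
    refine mul_le_mul ?_ (hSb x hx t ht) (norm_nonneg _) hk0.le
    simp only [RCLike.norm_ofNat]
    linarith
  have h5 : ‖laggedVisco c G a'' (N + 1) x t‖ ≤ k * V :=
    (hVb x hx t ht).trans (le_mul_of_one_le_left hV hk)
  rw [norm_mul, norm_mul, hE, one_mul, norm_inv, norm_pow, hnorm]
  have h6 := (norm_add_le _ _).trans (add_le_add ((norm_sub_le _ _).trans (add_le_add
    ((norm_add_le _ _).trans (add_le_add ((norm_add_le _ _).trans (add_le_add h1 h2)) h3)) h4)) h5)
  refine (mul_le_mul_of_nonneg_left h6 (by positivity)).trans (le_of_eq ?_)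
  rw [pow_succ]
  field_simp

theorem measure_prod_Ioo_lt_top (hΩ : Bornology.IsBounded Ω) :
    volume (Ω ×ˢ Ioo (0 : ℝ) T) < ⊤ :=
  (hΩ.prod (Metric.isBounded_Ioo 0 T)).measure_lt_top

theorem memL2_of_smoothST (hΩo : MeasurableSet Ω) (hΩ : Bornology.IsBounded Ω)
    {f : Space n → ℝ → ℂ} (hf : SmoothST f) : MemL2 Ω T f := by
  obtain ⟨M, -, hM⟩ := hf.exists_norm_le hΩ T
  have : IsFiniteMeasure (volume.restrict (Ω ×ˢ Ioo (0 : ℝ) T)) :=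
    ⟨by rw [Measure.restrict_apply_univ]; exact measure_prod_Ioo_lt_top hΩ⟩
  refine MemLp.of_bound (ContDiff.continuous hf).aestronglyMeasurable M ?_
  exact ae_restrict_of_forall_mem (hΩo.prod measurableSet_Ioo)
    fun p hp => hM _ hp.1 _ (Ioo_subset_Icc_self hp.2)

theorem normL2_le (hΩo : MeasurableSet Ω) (hΩ : Bornology.IsBounded Ω) {f : Space n → ℝ → ℂ}
    {M : ℝ} (hM0 : 0 ≤ M) (hM : ∀ x ∈ Ω, ∀ t ∈ Icc 0 T, ‖f x t‖ ≤ M) :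
    normL2 Ω T f ≤ ((volume (Ω ×ˢ Ioo (0 : ℝ) T)) ^ (1 / 2 : ℝ)).toReal * M := by
  have h := eLpNorm_le_of_ae_bound (p := 2) (μ := volume.restrict (Ω ×ˢ Ioo (0 : ℝ) T))
    (f := fun p : Space n × ℝ => f p.1 p.2) (C := M)
    (ae_restrict_of_forall_mem (hΩo.prod measurableSet_Ioo)
      fun p hp => hM _ hp.1 _ (Ioo_subset_Icc_self hp.2))
  rw [Measure.restrict_apply_univ] at h
  have hfin : volume (Ω ×ˢ Ioo (0 : ℝ) T) ^ (1 / 2 : ℝ) ≠ ⊤ :=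
    ENNReal.rpow_ne_top_of_nonneg (by norm_num) (measure_prod_Ioo_lt_top hΩ).ne
  have h2 : volume (Ω ×ˢ Ioo (0 : ℝ) T) ^ (ENNReal.toReal 2)⁻¹ =
      volume (Ω ×ˢ Ioo (0 : ℝ) T) ^ (1 / 2 : ℝ) := by
    norm_num
  rw [h2] at h
  have h3 := ENNReal.toReal_mono (ENNReal.mul_ne_top hfin ENNReal.ofReal_ne_top) h
  rwa [ENNReal.toReal_mul, ENNReal.toReal_ofReal hM0] at h3

end Estimate

/-! ### Dependence on c only through its germ, and a globally positive replacement -/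

section Locality

variable {n : ℕ} {c d : Space n → ℝ} {G : Space n → ℝ → ℝ} {ψ : Space n → ℝ} {x : Space n}
  {t : ℝ}

theorem divGrad_congr {F : Type} [NormedAddCommGroup F] [NormedSpace ℝ F] (h : c =ᶠ[𝓝 x] d)
    (f : Space n → F) : divGrad c f x = divGrad d f x := by
  refine Finset.sum_congr rfl fun j _ => ?_
  have h' : (fun y => c y • pderiv j f y) =ᶠ[𝓝 x] fun y => d y • pderiv j f y :=
    h.mono fun y hy => by simp only [hy]
  rw [pderiv, pderiv, h'.fderiv_eq]

theorem waveOp_congr (h : c =ᶠ[𝓝 x] d) (a : Space n → ℝ → ℂ) :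
    waveOp c a x t = waveOp d a x t := by
  simp only [waveOp, divGrad_congr h]

theorem viscoOp_congr (h : c =ᶠ[𝓝 x] d) (a : Space n → ℝ → ℂ) :
    viscoOp c G a x t = viscoOp d G a x t := by
  simp only [viscoOp, waveOp_congr h]

theorem memA_congr (h : c =ᶠ[𝓝 x] d) (a : Space n → ℝ → ℂ) :
    memA c G a x = memA d G a x := by
  funext t s
  simp only [memA, h.eq_of_nhds]

theorem transportOp_congr (h : c =ᶠ[𝓝 x] d) (a : Space n → ℝ → ℂ) :
    transportOp c G ψ a x t = transportOp d G ψ a x t := by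
  simp only [transportOp, transportCoeff, divGrad_congr h, h.eq_of_nhds]

theorem transportSource_congr_speed (h : c =ᶠ[𝓝 x] d) (a : ℕ → Space n → ℝ → ℂ) (l : ℕ) :
    transportSource c G ψ a l x t = transportSource d G ψ a l x t := by
  cases l with
  | zero => rfl
  | succ l => simp only [transportSource, waveOp_congr h, memA_congr h]

theorem volterraOp_congr (h : c =ᶠ[𝓝 x] d) (a : Space n → ℝ → ℂ) :
    volterraOp c G a x t = volterraOp d G a x t := by
  simp only [volterraOp, h.eq_of_nhds]

theorem firstOrderOp_congr (h : c =ᶠ[𝓝 x] d) (a : Space n → ℝ → ℂ) :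
    firstOrderOp c G ψ a x t = firstOrderOp d G ψ a x t := by
  simp only [firstOrderOp, divGrad_congr h, h.eq_of_nhds]

theorem volterraLower_congr_speed (h : c =ᶠ[𝓝 x] d) (a : ℕ → Space n → ℝ → ℂ) (l : ℕ) :
    volterraLower c G ψ a l x t = volterraLower d G ψ a l x t := by
  match l with
  | 0 => rfl
  | 1 => simp only [volterraLower, firstOrderOp_congr h]
  | l + 2 => simp only [volterraLower, firstOrderOp_congr h, viscoOp_congr h]

theorem volterraSource_congr_speed (h : c =ᶠ[𝓝 x] d) (a' a'' : ℕ → Space n → ℝ → ℂ) (l : ℕ) :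
    volterraSource c G ψ a' a'' l x t = volterraSource d G ψ a' a'' l x t := by
  simp only [volterraSource, volterraLower_congr_speed h, memA_congr h]

theorem exists_contDiff_pos_eq_self {δ : ℝ} (hδ : 0 < δ) :
    ∃ h : ℝ → ℝ, ContDiff ℝ ∞ h ∧ (∀ s, 0 < h s) ∧ ∀ s, δ ≤ s → h s = s := by
  -- The transition vanishes for s ≤ δ/2 and equals one for s ≥ δ, so h is the constant δ, then a
  -- convex combination of the positive numbers s and δ, then s.
  let σ : ℝ → ℝ := fun s => Real.smoothTransition (2 * s / δ - 1)
  have hσ : ContDiff ℝ ∞ σ := Real.smoothTransition.contDiff.comp (by fun_prop)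
  refine ⟨fun s => σ s * s + (1 - σ s) * δ, by fun_prop, fun s => ?_, fun s hs => ?_⟩
  · rcases le_or_gt s (δ / 2) with h | h
    · have : σ s = 0 := Real.smoothTransition.zero_of_nonpos (by
        rw [sub_nonpos, div_le_one hδ]
        linarith)
      simpa [this] using hδ
    · have h0 : 0 ≤ σ s := Real.smoothTransition.nonneg _
      have h1 : σ s ≤ 1 := Real.smoothTransition.le_one _
      nlinarith [mul_nonneg h0 (by linarith : 0 ≤ s - δ / 2)]
  · have : σ s = 1 := Real.smoothTransition.one_of_one_le (by
      rw [le_sub_iff_add_le, le_div_iff₀ hδ]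
      linarith)
    simp [this]

theorem exists_contDiff_pos_eqOn {Ω : Set (Space n)} (hΩ : Bornology.IsBounded Ω)
    (hc : ContDiff ℝ ∞ c) (hpos : ∀ x ∈ closure Ω, 0 < c x) :
    ∃ d : Space n → ℝ, ContDiff ℝ ∞ d ∧ (∀ x, 0 < d x) ∧ EqOn c d Ω := by
  obtain ⟨δ, hδ, h⟩ := hΩ.isCompact_closure.exists_forall_le' hc.continuous.continuousOn hpos
  obtain ⟨f, hf, hf0, hfs⟩ := exists_contDiff_pos_eq_self hδ
  exact ⟨fun x => f (c x), hf.comp hc, fun x => hf0 _,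
    fun x hx => (hfs _ (h x (subset_closure hx))).symm⟩

end Locality

end Viscoacoustic

end

/-! ### The theorem -/

open Viscoacoustic in
theorem proposition2p1 (n : ℕ) (hn : 2 ≤ n)
    (Ω : Set (EuclideanSpace ℝ (Fin n))) (hΩ : IsOpen Ω) (hΩb : Bornology.IsBounded Ω)
    (T : ℝ) (hT : 0 < T)
    (c : EuclideanSpace ℝ (Fin n) → ℝ) (hc : ContDiff ℝ ∞ c) (hcpos : ∀ x ∈ closure Ω, 0 < c x)
    (G : EuclideanSpace ℝ (Fin n) → ℝ → ℝ) (hG : SmoothST G)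
    (ψ : EuclideanSpace ℝ (Fin n) → ℝ) (hψ : ContDiff ℝ ∞ ψ)
    (heik : ∀ x ∈ Ω, ‖gradient ψ x‖ = 1 / √(c x))
    (a₀ : EuclideanSpace ℝ (Fin n) → ℝ → ℂ) (ha₀ : SmoothST a₀)
    (htr : ∀ x ∈ Ω, ∀ t ∈ Icc 0 T, transportOp c G ψ a₀ x t = 0) :
    ∀ N : ℕ, ∃ a' a'' : ℕ → EuclideanSpace ℝ (Fin n) → ℝ → ℂ,
      ∃ u : ℝ → EuclideanSpace ℝ (Fin n) → ℝ → ℂ,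
        a' 0 = a₀ ∧
        (∀ l, SmoothST (a' l)) ∧ (∀ l, SmoothST (a'' l)) ∧
        (∀ l, ∀ x ∈ Ω, ∀ t ∈ Icc 0 T,
          transportOp c G ψ (a' l) x t = transportSource c G ψ a' l x t) ∧
        (∀ l, ∀ x ∈ Ω, ∀ t ∈ Icc 0 T,
          volterraOp c G (a'' l) x t = volterraSource c G ψ a' a'' l x t) ∧
        (∀ k, 0 < k → u k = ansatz ψ a' a'' (N + 1) k) ∧
        (∀ k, 0 < k → SmoothST (u k)) ∧
        (∀ k, 0 < k → MemL2 Ω T (viscoOp c G (u k))) ∧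
        (fun k => normL2 Ω T (viscoOp c G (u k))) =O[atTop] (fun k : ℝ => (k ^ N)⁻¹) := by
  intro N
  -- The speed c is positive only on the closure of Ω, while the constructions divide by it
  -- everywhere; d is a positive substitute with the same germs at points of Ω.
  obtain ⟨d, hd, hd0, hcd⟩ := exists_contDiff_pos_eqOn hΩb hc hcpos
  have hloc : ∀ x ∈ Ω, c =ᶠ[nhds x] d := fun x hx =>
    hcd.eventuallyEq_of_mem (hΩ.mem_nhds hx)
  obtain ⟨a', h0, ha', htr'⟩ := exists_transport_amplitudes hΩb hd hd0 hG hψ ha₀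
  obtain ⟨a'', ha'', hvo⟩ := exists_volterra_amplitudes hd hd0 hG hψ ha'
  have htrd : ∀ l, ∀ x ∈ Ω, ∀ t ∈ Icc 0 T,
      transportOp d G ψ (a' l) x t = transportSource d G ψ a' l x t := by
    intro l x hx t ht
    cases l with
    | zero =>
      rw [h0, ← transportOp_congr (hloc x hx), htr x hx t ht]
      rfl
    | succ l => exact htr' l x hx t
  have heikd : ∀ x ∈ Ω, ‖gradient ψ x‖ ^ 2 = (d x)⁻¹ := by
    intro x hx
    rw [heik x hx, hcd hx, div_pow, Real.sq_sqrt (hd0 x).le, one_pow, one_div]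
  obtain ⟨M, hM⟩ := exists_norm_viscoOp_ansatz_le hd hd0 hG hψ hΩb heikd ha' ha'' htrd
    (fun l x _ t _ => hvo l x t) N
  have hu : ∀ k, SmoothST (ansatz ψ a' a'' (N + 1) k) := smoothST_ansatz hψ ha' ha'' (N + 1)
  refine ⟨a', a'', ansatz ψ a' a'' (N + 1), h0, ha', ha'', fun l x hx t ht => ?_,
    fun l x hx t _ => ?_, fun _ _ => rfl, fun k _ => hu k,
    fun k _ => memL2_of_smoothST hΩ.measurableSet hΩb (smoothST_viscoOp hc hG (hu k)), ?_⟩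
  · rw [transportOp_congr (hloc x hx), transportSource_congr_speed (hloc x hx)]
    exact htrd l x hx t ht
  · rw [volterraOp_congr (hloc x hx), volterraSource_congr_speed (hloc x hx)]
    exact hvo l x t
  · refine IsBigO.of_bound
      (((volume (Ω ×ˢ Ioo (0 : ℝ) T)) ^ (1 / 2 : ℝ)).toReal * max M 0) ?_
    filter_upwards [eventually_ge_atTop 1] with k hk
    have hk0 : 0 < k := one_pos.trans_le hk
    have hb := normL2_le (T := T) hΩ.measurableSet hΩb
      (f := viscoOp c G (ansatz ψ a' a'' (N + 1) k)) (M := max M 0 * (k ^ N)⁻¹) (by positivity)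
      fun x hx t ht => by
        rw [viscoOp_congr (hloc x hx)]
        refine (hM k hk x hx t ht).trans ?_
        gcongr
        exact le_max_left _ _
    rw [Real.norm_of_nonneg (by unfold normL2; positivity),
      Real.norm_of_nonneg (by positivity), mul_assoc]
    exact hb
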